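/- **Setting.** $V\ge 1$ agents are the nodes of a connected undirected graph $G$ on $[V]$; $\mathcal N(i)$ denotes the set consisting of $i$ and its neighbors, $v_i=\min_{j\in\mathcal N(i)}|\mathcal N(j)|$ and $v_{\min}=\min_{j\in[V]}|\mathcal N(j)|$. There are $K\ge1$ arms with reward distributions $\nu_1,\dots,\nu_K$ on $[0,1]$ with means $\mu_k$; $\mu_{k^*}=\max_k\mu_k$, $\Delta_k=\mu_{k^*}-\mu_k$, $\Delta=\min_{\Delta_k>0}\Delta_k$. In each of $T$ rounds every agent $i$ pulls an arm $k_{i,t}$ and gets a reward $r_{i,t}\sim\nu_{k_{i,t}}$, independently over agents and rounds; $R_i(T)=T\mu_{k^*}-\mathbb E\big[\sum_{t=1}^T r_{i,t}\big]$. The communication cost $\mathrm{Cost}(T)$ is the number of pairs (agent $i$, round $t\le T$) such that $i$ broadcasts at $t$. A set $\mathcal C\subseteq[V]$ of agents is Byzantine, with $|\mathcal C\cap\mathcal N(i)|\le\alpha|\mathcal N(i)|$ for every normal agent $i\notin\mathcal C$, where $\alpha\in[0,\tfrac12)$ is known. Byzantine agents pull arbitrary arms and send arbitrary real-valued messages,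 possibly different ones to different neighbors; both may depend on everything that has happened in the system so far and on private randomness. **Algorithm** (DeMABAR with $w=1$; run by every normal agent $i$). Let $\lambda=2^9\ln(2VT)$ and $\Delta^0_{i,k}=1$ for all $k$. Epoch $m=1,2,\dots$ has $N_m=\big\lceil \lambda K2^{2(m-1)}/((1-2\alpha)v_{\min})\big\rceil$ exploration rounds and one communication round; the algorithm is stopped after round $T$. * Select an arm $k_i^m$ with $\Delta^{m-1}_{i,k_i^m}=2^{-(m-1)}$ (ties broken by any fixed rule). For $k\ne k_i^m$ let $\tilde n^m_{i,k}=\min\Big\{\frac{16\lambda(\Delta^{m-1}_{i,k})^{-2}}{(1-2\alpha)v_i},\frac{\lambda2^{2(m-1)}}{(1-2\alpha)v_i}\Big\}$, and let $\tilde n^m_{i,k_i^m}=N_m-\sum_{k\ne k_i^m}\tilde n^m_{i,k}$. * In each exploration round pull an arm drawn from $p_i^m(k)=\tilde n^m_{i,k}/N_m$; $S^m_{i,k}$ is the sum of the rewards obtained from arm $k$ in these rounds. * In the communication round pull $k_i^m$, broadcast $(\{S^m_{i,k}\}_k,\{\tilde n^m_{i,k}\}_k)$ to the neighbors and receive their messages.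 * For each arm $k$: let $n=\frac{\lambda(\Delta^{m-1}_{i,k})^{-2}}{(1-2\alpha)|\mathcal N(i)|}$ and $\mathcal A=\{j\in\mathcal N(i):\tilde n^m_{j,k}\ge n\}$ (according to the messages received); if $|\mathcal A|<(1-2\alpha)|\mathcal N(i)|$, reset $\mathcal A=\mathcal N(i)$. Let $f=\big\lfloor\frac12(|\mathcal A|-(1-2\alpha)|\mathcal N(i)|)\big\rfloor$, and let $r^m_{i,k}$ be the minimum of $1$ and the average of the values $S^m_{j,k}/\tilde n^m_{j,k}$, $j\in\mathcal A$, that remain after the $f$ largest and the $f$ smallest are removed. * Let $r^m_{i,*}=\max_k\{r^m_{i,k}-\frac18\Delta^{m-1}_{i,k}\}$ and $\Delta^m_{i,k}=\max\{2^{-m},r^m_{i,*}-r^m_{i,k}\}$. Only messages sent in communication rounds are read, and only these broadcasts are counted, for Byzantine agents as well. **Theorem.** There is a universal constant $C>0$ such that, for all $V$ and $K$: (1) for every $T\ge1$, every network and every admissible $\alpha$ and $\mathcal C$, $\ \mathrm{Cost}(T)\le C\,V\ln(VT)$; (2) for all sufficiently large $T$ (with a threshold that depends only on $V$ and $K$),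 for every network $G$, every $\alpha\in[0,\frac12)$, all reward distributions $\nu_1,\dots,\nu_K$ on $[0,1]$, every set $\mathcal C$ of Byzantine agents as above with any behavior, and every normal agent $i$, $$R_i(T)\le C\,\frac{\ln(VT)}{1-2\alpha}\bigg(\sum_{\Delta_k>0}\frac{\ln(VT)}{v_i\,\Delta_k}+\frac{K\ln(\frac1\Delta)}{v_{\min}\,\Delta}\bigg),$$ where the right-hand side is read as $0$ if all arms are optimal. -/

import Mathlib

open MeasureTheory ProbabilityTheory

noncomputable section

namespace DeMABAR

/-- The `w`-neighbourhood of `i`: all nodes at graph distance at most `w` (in particular `i`). -/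
def nbhd {V : ℕ} (G : SimpleGraph (Fin V)) (w : ℕ) (i : Fin V) : Finset (Fin V) :=
  open Classical in Finset.univ.filter fun j => G.dist i j ≤ w

/-- `v_i^w`, the least size of a `w`-neighbourhood of a node in the `w`-neighbourhood of `i`. -/
def vLoc {V : ℕ} (G : SimpleGraph (Fin V)) (w : ℕ) (i : Fin V) : ℕ :=
  ⨅ j : {j : Fin V // j ∈ nbhd G w i}, (nbhd G w j.1).card

/-- `v_min^w`, the least size of a `w`-neighbourhood. -/
def vMin {V : ℕ} (G : SimpleGraph (Fin V)) (w : ℕ) : ℕ :=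
  ⨅ j : Fin V, (nbhd G w j).card

/-- The data the algorithm is run with. Rounds are numbered `0, …, T - 1` and epochs
`0, 1, 2, …`. The rule `sel m i` picks one arm among those that qualify as the leading arm
of agent `i` in epoch `m`. -/
structure Setup (V K : ℕ) where
  /-- the communication network -/
  G : SimpleGraph (Fin V)
  /-- the tolerated fraction of Byzantine neighbours -/
  α : ℝ
  /-- the horizon -/
  T : ℕ
  /-- the set of Byzantine agents (not known to the algorithm) -/
  byz : Finset (Fin V)
  /-- how the algorithm breaks ties when it selects the leading arm -/
  sel : ℕ → Fin V → Finset (Fin K) → Fin K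

/-- The standing assumptions of the Byzantine setting. -/
structure Setup.Admissible {V K : ℕ} (P : Setup V K) : Prop where
  connected : P.G.Connected
  alpha_nonneg : 0 ≤ P.α
  alpha_lt : P.α < 1 / 2
  byz_fraction : ∀ i, i ∉ P.byz →
    ((P.byz ∩ nbhd P.G 1 i).card : ℝ) ≤ P.α * ((nbhd P.G 1 i).card : ℝ)
  sel_mem : ∀ m i s, s.Nonempty → P.sel m i s ∈ s

/-- A message `(S, ñ)`: for every arm, a reward sum and a number of pulls. -/
abbrev Message (K : ℕ) := (Fin K → ℝ) × (Fin K → ℝ)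

/-- Everything that drives one run, for one outcome of the randomness. -/
structure Path (V K : ℕ) where
  /-- `u t i`: the seed with which agent `i` draws its arm in round `t` -/
  u : ℕ → Fin V → ℝ
  /-- `x t i k`: the reward agent `i` gets in round `t` if it pulls arm `k` -/
  x : ℕ → Fin V → Fin K → ℝ
  /-- `z m j i`: what a Byzantine agent `j` sends to agent `i` at the end of epoch `m` -/
  z : ℕ → Fin V → Fin V → Message K
  /-- `a t j`: the arm a Byzantine agent `j` pulls in round `t` -/
  a : ℕ → Fin V → Fin K

/-- Drawing from the probability vector `p` by inversion: the first arm whose cumulative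
probability exceeds the seed. -/
def draw {K : ℕ} [NeZero K] (p : Fin K → ℝ) (u : ℝ) : Fin K :=
  open Classical in
  if h : (Finset.univ.filter fun k => u < ∑ l ∈ Finset.Iic k, p l).Nonempty
  then (Finset.univ.filter fun k => u < ∑ l ∈ Finset.Iic k, p l).min' h
  else 0

/-- The average of the numbers `y j`, `j ∈ A`, without the `f` largest and the `f` smallest. -/
def trimmedMean {V : ℕ} (A : Finset (Fin V)) (f : ℕ) (y : Fin V → ℝ) : ℝ :=
  let kept := (((A.val.map y).sort (· ≥ ·)).drop f).take (A.card - 2 * f)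
  kept.sum / (kept.length : ℝ)

namespace Setup

variable {V K : ℕ} (P : Setup V K)

/-- `λ = 2⁹ ln(2VT)`. -/
def lam : ℝ := 2 ^ 9 * Real.log (2 * V * P.T)

/-- The number of exploration rounds of epoch `m`. -/
def len (m : ℕ) : ℕ :=
  ⌈P.lam * K * 2 ^ (2 * m) / ((1 - 2 * P.α) * vMin P.G 1)⌉₊

/-- The first round of epoch `m`: an epoch has `len m` exploration rounds, followed by one
communication round. -/
def start : ℕ → ℕ
  | 0 => 0
  | m + 1 => start m + P.len m + 1

/-- The epoch to which round `t` belongs. -/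
def epoch (t : ℕ) : ℕ := Nat.findGreatest (fun m => P.start m ≤ t) t

/-- Round `t` is the communication round of its epoch. -/
def IsComm (t : ℕ) : Prop := t = P.start (P.epoch t) + P.len (P.epoch t)

/-- The communication cost: the number of pairs (agent, round) such that the agent broadcasts
in that round. Agents broadcast in the communication rounds only; Byzantine agents are counted
as well, and what they might send in other rounds is never read. -/
def cost : ℕ :=
  open Classical in ∑ _i : Fin V, ∑ t ∈ Finset.range P.T, if P.IsComm t then 1 else 0

/-- The leading arm in epoch `m` of agent `i`, whose gap estimates are `Δ`. -/
def lead (m : ℕ) (i : Fin V) (Δ : Fin K → ℝ) : Fin K :=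
  open Classical in P.sel m i (Finset.univ.filter fun k => Δ k = (1 / 2) ^ m)

/-- The intended number of pulls of an arm with gap estimate `δ` that is not leading. -/
def baseAlloc (m : ℕ) (i : Fin V) (δ : ℝ) : ℝ :=
  min (16 * P.lam * (δ ^ 2)⁻¹ / ((1 - 2 * P.α) * vLoc P.G 1 i))
    (P.lam * 2 ^ (2 * m) / ((1 - 2 * P.α) * vLoc P.G 1 i))

/-- `ñ`: the intended number of pulls of arm `k` by agent `i` in epoch `m`; the leading arm
takes all the rounds that the other arms leave. -/
def alloc (m : ℕ) (i : Fin V) (Δ : Fin K → ℝ) (k : Fin K) : ℝ :=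
  open Classical in
  if k = P.lead m i Δ
  then P.len m - ∑ l ∈ Finset.univ.erase (P.lead m i Δ), P.baseAlloc m i (Δ l)
  else P.baseAlloc m i (Δ k)

/-- The arm agent `i` draws in an exploration round of epoch `m` with seed `u`. -/
def explore [NeZero K] (m : ℕ) (i : Fin V) (Δ : Fin K → ℝ) (u : ℝ) : Fin K :=
  draw (fun k => P.alloc m i Δ k / P.len m) u

/-- `S`: the rewards agent `i` collects from arm `k` in the exploration rounds of epoch `m`. -/
def rewardSum [NeZero K] (m : ℕ) (i : Fin V) (Δ : Fin K → ℝ) (ξ : Path V K) (k : Fin K) : ℝ :=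
  ∑ t ∈ Finset.Ico (P.start m) (P.start m + P.len m),
    if P.explore m i Δ (ξ.u t i) = k then ξ.x t i k else 0

/-- The message that `i` gets from `j` at the end of epoch `m`: the true one if `j` is normal,
any one if `j` is Byzantine. -/
def message [NeZero K] (m : ℕ) (Δ : Fin V → Fin K → ℝ) (ξ : Path V K) (j i : Fin V) :
    Message K :=
  if j ∈ P.byz then ξ.z m j i else (P.rewardSum m j (Δ j) ξ, P.alloc m j (Δ j))

/-- The filter step of agent `i` for arm `k`, with gap estimate `δ` and messages `msg j`.
Messages with too small a number of pulls are removed; if this leaves too few of them, all are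
restored. -/
def estimate (i : Fin V) (δ : ℝ) (msg : Fin V → Message K) (k : Fin K) : ℝ :=
  open Classical in
  let N := nbhd P.G 1 i
  let n := P.lam * (δ ^ 2)⁻¹ / ((1 - 2 * P.α) * N.card)
  let A₀ := N.filter fun j => n ≤ (msg j).2 k
  let A := if (A₀.card : ℝ) < (1 - 2 * P.α) * N.card then N else A₀
  let f := ⌊((A.card : ℝ) - (1 - 2 * P.α) * N.card) / 2⌋₊
  min (trimmedMean A f fun j => (msg j).1 k / (msg j).2 k) 1

/-- `gap ξ m i k`: the estimate by agent `i` of the gap of arm `k` at the start of epoch `m`. -/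
def gap [NeZero K] (ξ : Path V K) : ℕ → Fin V → Fin K → ℝ
  | 0 => fun _ _ => 1
  | m + 1 => fun i k =>
      let r : Fin K → ℝ := fun l =>
        P.estimate i (gap ξ m i l) (fun j => P.message m (gap ξ m) ξ j i) l
      max ((1 / 2) ^ (m + 1)) ((⨆ l, (r l - gap ξ m i l / 8)) - r k)

/-- The arm that agent `i` pulls in round `t`. -/
def arm [NeZero K] (ξ : Path V K) (t : ℕ) (i : Fin V) : Fin K :=
  open Classical in
  if i ∈ P.byz then ξ.a t i
  else if P.IsComm t then P.lead (P.epoch t) i (P.gap ξ (P.epoch t) i)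
  else P.explore (P.epoch t) i (P.gap ξ (P.epoch t) i) (ξ.u t i)

/-- The random environment, with reward distributions `ν k`, together with the behaviour of the
Byzantine agents. In each round, the seeds are uniform on `[0, 1]` and the reward vectors have
independent coordinates with laws `ν k`, independently over agents and independently of the
past. The σ-algebra `ℱ t` holds everything known before round `t`, including any private
randomness of the Byzantine agents; these may use all that has happened in the whole system. -/
structure Environment (ν : Fin K → Measure ℝ) {Ω : Type*} [mΩ : MeasurableSpace Ω]
    (Q : Measure Ω) where
  ℱ : Filtration ℕ mΩ
  path : Ω → Path V K
  measurable_u : ∀ t i, Measurable[ℱ (t + 1)] fun ω => (path ω).u t i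
  measurable_x : ∀ t i, Measurable[ℱ (t + 1)] fun ω => (path ω).x t i
  measurable_z : ∀ m j i, Measurable[ℱ (P.start (m + 1))] fun ω => (path ω).z m j i
  measurable_a : ∀ t j, Measurable[ℱ (t + 1)] fun ω => (path ω).a t j
  law : ∀ t, Q.map (fun ω (i : Fin V) => ((path ω).u t i, (path ω).x t i)) =
    Measure.pi fun _ => ((volume.restrict (Set.Icc (0 : ℝ) 1)).prod (Measure.pi ν))
  indep : ∀ t, Indep (ℱ t)
    (MeasurableSpace.comap (fun ω (i : Fin V) => ((path ω).u t i, (path ω).x t i)) inferInstance)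
    Q

end Setup

variable {K : ℕ}

/-- `μ_k`. -/
def mean (ν : Fin K → Measure ℝ) (k : Fin K) : ℝ := ∫ y, y ∂(ν k)

/-- `μ_{k*}`. -/
def bestMean (ν : Fin K → Measure ℝ) : ℝ := ⨆ k, mean ν k

/-- `Δ_k`. -/
def subGap (ν : Fin K → Measure ℝ) (k : Fin K) : ℝ := bestMean ν - mean ν k

/-- `Δ`, the smallest positive gap. -/
def minGap (ν : Fin K → Measure ℝ) : ℝ := ⨅ k : {k : Fin K // 0 < subGap ν k}, subGap ν k.1

/-- `R_i(T) = T μ_{k*} - E[∑_t r_{i,t}]`. -/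
def regret {V : ℕ} [NeZero K] (P : Setup V K) (ν : Fin K → Measure ℝ) {Ω : Type*}
    [MeasurableSpace Ω] {Q : Measure Ω} (E : P.Environment ν Q) (i : Fin V) : ℝ :=
  P.T * bestMean ν -
    ∫ ω, ∑ t ∈ Finset.range P.T, (E.path ω).x t i (P.arm (E.path ω) t i) ∂Q

end DeMABAR

end

/-!
Call an epoch accurate if, for every agent `i` and arm `k`, every set of at least
`(1 - 2α)|𝒩(i)|` agents that all announce enough pulls has an average empirical mean within
`Δ / 8` of `μ_k`, where `Δ` is the current gap estimate. Given the past, the announced numbers of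
pulls are the expected ones, so exponentially tilted rewards form a supermartingale, and an average
of this kind fails with probability at most `2(2VT)⁻²`. A union bound over epochs, agents, arms and
sets of agents shows that all epochs are accurate up to probability `K2^V / T`; the regret of the
exceptional runs is at most `K2^V`, which is negligible as soon as `T ≥ exp(K2^V)`.

At most `f` of the values that enter a trimmed mean are Byzantine, so exchanging kept values for
trimmed ones bounds it from both sides by averages over normal agents. By induction over accurate
epochs, the gap estimate of arm `k` in epoch `m` is `Δ_k` up to constant factors and `2⁻ᵐ`. An arm
that is not leading therefore costs `O(λ / ((1 - 2α) v_i Δ_k))` in each of the `O(ln(VT))` epochs.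
The leading arm has gap `O(2⁻ᵐ)`, hence is optimal once `2ᵐ > 3 / Δ`; its costs `N_m 2⁻ᵐ` in the
earlier epochs add up to `O(λK / ((1 - 2α) v_min Δ))`. When `Δ` is close to `1`, the factor
`ln(1/Δ)` is too small to absorb this, but then the sum over the arms does.
-/

namespace DeMABAR

/-! ### Trimmed means -/

section TrimmedMean

theorem exists_list_pairwise_ge {ι α : Type*} [LinearOrder α] (A : Finset ι) (y : ι → α) :
    ∃ L : List ι, (L : Multiset ι) = A.val ∧ L.Pairwise fun a b => y b ≤ y a := by
  refine ⟨A.toList.mergeSort fun a b => decide (y b ≤ y a), ?_, ?_⟩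
  · rw [Multiset.coe_eq_coe.mpr (List.mergeSort_perm _ _), Finset.coe_toList]
  · simpa using List.pairwise_mergeSort (le := fun a b => decide (y b ≤ y a))
      (fun _ _ _ hab hbc => by simp only [decide_eq_true_eq] at *; exact hbc.trans hab)
      (fun a b => by simpa using le_total (y b) (y a)) A.toList

variable {V : ℕ} {A g : Finset (Fin V)} {y : Fin V → ℝ} {f : ℕ}

theorem trimmedMean_eq_of_pairwise_ge {L : List (Fin V)} (hL : (L : Multiset (Fin V)) = A.val)
    (hy : L.Pairwise fun a b => y b ≤ y a) :
    trimmedMean A f y =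
      (((L.drop f).take (A.card - 2 * f)).map y).sum / ((A.card - 2 * f : ℕ) : ℝ) := by
  have hsort : (A.val.map y).sort (· ≥ ·) = L.map y := by
    refine List.Perm.eq_of_pairwise (fun _ _ _ _ hab hba => le_antisymm hba hab)
      (Multiset.pairwise_sort _ _) (List.pairwise_map.mpr hy) ?_
    rw [← Multiset.coe_eq_coe, Multiset.sort_eq, ← hL, Multiset.map_coe]
  have hcard : A.card = L.length := by rw [Finset.card_def, ← hL, Multiset.coe_card]
  have hlength : ((L.drop f).take (A.card - 2 * f)).length = A.card - 2 * f := by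
    rw [List.length_take, List.length_drop]; omega
  simp only [trimmedMean, hsort, ← List.map_drop, ← List.map_take, List.length_map, hlength]

theorem exists_trimmedMean_eq (A : Finset (Fin V)) (f : ℕ) (y : Fin V → ℝ)
    (hf : 2 * f ≤ A.card) :
    ∃ mid ⊆ A, mid.card = A.card - 2 * f ∧ trimmedMean A f y = (∑ j ∈ mid, y j) / mid.card ∧
      (∃ top ⊆ A \ mid, top.card = f ∧ ∀ a ∈ top, ∀ b ∈ mid, y b ≤ y a) ∧
      ∃ bot ⊆ A \ mid, bot.card = f ∧ ∀ a ∈ mid, ∀ b ∈ bot, y b ≤ y a := by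
  obtain ⟨L, hL, hy⟩ := exists_list_pairwise_ge A y
  have hmean := trimmedMean_eq_of_pairwise_ge (f := f) hL hy
  have hcard : A.card = L.length := by rw [Finset.card_def, ← hL, Multiset.coe_card]
  have hA : ∀ a, a ∈ A ↔ a ∈ L := fun a => by rw [← Finset.mem_val, ← hL, Multiset.mem_coe]
  have hnodup : L.Nodup := by rw [← Multiset.coe_nodup, hL]; exact A.nodup
  obtain ⟨L₁, L₂, L₃, rfl, h₁, h₂, h₃, hmid⟩ : ∃ L₁ L₂ L₃, L = L₁ ++ (L₂ ++ L₃) ∧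
      L₁.length = f ∧ L₂.length = A.card - 2 * f ∧ L₃.length = f ∧
      (L.drop f).take (A.card - 2 * f) = L₂ := by
    refine ⟨L.take f, _, (L.drop f).drop (A.card - 2 * f), ?_, ?_, ?_, ?_, rfl⟩ <;>
      simp only [List.take_append_drop, List.length_take, List.length_drop] <;> omega
  rw [hmid] at hmean
  simp only [List.nodup_append', List.disjoint_append_right] at hnodup
  obtain ⟨n₁, ⟨n₂, n₃, d₂₃⟩, d₁₂, -⟩ := hnodup
  simp only [List.pairwise_append, List.mem_append] at hy hA
  refine ⟨L₂.toFinset, fun a ha => ?_, ?_, ?_, ⟨L₁.toFinset, fun a ha => ?_, ?_, ?_⟩,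
    L₃.toFinset, fun a ha => ?_, ?_, ?_⟩
  · exact (hA a).mpr (.inr (.inl (List.mem_toFinset.mp ha)))
  · rw [List.toFinset_card_of_nodup n₂, h₂]
  · rw [hmean, List.sum_toFinset _ n₂, List.toFinset_card_of_nodup n₂, h₂]
  · rw [List.mem_toFinset] at ha
    exact Finset.mem_sdiff.mpr ⟨(hA a).mpr (.inl ha), fun h => d₁₂ ha (List.mem_toFinset.mp h)⟩
  · rw [List.toFinset_card_of_nodup n₁, h₁]
  · simpa only [List.mem_toFinset] using fun a ha b hb => hy.2.2 a ha b (.inl hb)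
  · rw [List.mem_toFinset] at ha
    exact Finset.mem_sdiff.mpr
      ⟨(hA a).mpr (.inr (.inr ha)), fun h => d₂₃ (List.mem_toFinset.mp h) ha⟩
  · rw [List.toFinset_card_of_nodup n₃, h₃]
  · simpa only [List.mem_toFinset] using hy.2.1.2.2

-- The elements of `mid` outside `g` are exchanged for as many elements of `top` inside `g`.
theorem exists_subset_card_eq_sum_le {ι α : Type*} [DecidableEq ι] [AddCommMonoid α]
    [LinearOrder α] [IsOrderedAddMonoid α] {A g top mid : Finset ι} {y : ι → α}
    (htop : top ⊆ A \ mid) (hmid : mid ⊆ A) (hy : ∀ a ∈ top, ∀ b ∈ mid, y b ≤ y a)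
    (hg : (A \ g).card ≤ top.card) :
    ∃ W ⊆ g, W.card = mid.card ∧ ∑ j ∈ mid, y j ≤ ∑ j ∈ W, y j := by
  have hcard : (mid \ g).card ≤ (top ∩ g).card := by
    have hle : ((mid \ g) ∪ (top \ g)).card ≤ (A \ g).card :=
      Finset.card_le_card (by grind)
    rw [Finset.card_union_of_disjoint (Finset.disjoint_left.mpr (by grind))] at hle
    have := Finset.card_sdiff_add_card_inter top g
    omega
  obtain ⟨U, hU, hUcard⟩ := Finset.exists_subset_card_eq hcard
  have hdisj : Disjoint (mid ∩ g) U := Finset.disjoint_left.mpr (by grind)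
  refine ⟨(mid ∩ g) ∪ U, by grind, ?_, ?_⟩
  · rw [Finset.card_union_of_disjoint hdisj, hUcard, add_comm, Finset.card_sdiff_add_card_inter]
  · rw [Finset.sum_union hdisj, ← Finset.sum_inter_add_sum_sdiff mid g]
    refine add_le_add_right ?_ _
    rcases (mid \ g).eq_empty_or_nonempty with hempty | hne
    · rw [hempty, Finset.card_empty, Finset.card_eq_zero] at hUcard
      rw [hempty, hUcard]
    · obtain ⟨b, hb, hmax⟩ := Finset.exists_max_image (mid \ g) y hne
      calc ∑ j ∈ mid \ g, y j ≤ (mid \ g).card • y b := Finset.sum_le_card_nsmul _ _ _ hmax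
        _ = U.card • y b := by rw [hUcard]
        _ ≤ ∑ j ∈ U, y j := Finset.card_nsmul_le_sum _ _ _ fun a ha => hy a (by grind) b (by grind)

theorem abs_trimmedMean_sub_le {c ε : ℝ} (hf : 2 * f ≤ A.card) (hg : (A \ g).card ≤ f)
    (h : ∀ W ⊆ g, W.card = A.card - 2 * f → |(∑ j ∈ W, y j) / W.card - c| ≤ ε) :
    |trimmedMean A f y - c| ≤ ε := by
  obtain ⟨mid, hmid, hcard, hmean, ⟨top, htop, rfl, hytop⟩, bot, hbot, hbotcard, hybot⟩ :=
    exists_trimmedMean_eq A f y hf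
  obtain ⟨U, hU, hUcard, hUsum⟩ := exists_subset_card_eq_sum_le htop hmid hytop hg
  obtain ⟨W, hW, hWcard, hWsum⟩ := exists_subset_card_eq_sum_le (y := fun j => -y j) hbot hmid
    (fun a ha b hb => neg_le_neg (hybot b hb a ha)) (hg.trans hbotcard.ge)
  have hupper := (abs_le.mp (h U hU (hUcard.trans hcard))).2
  have hlower := (abs_le.mp (h W hW (hWcard.trans hcard))).1
  rw [hUcard] at hupper
  rw [hWcard] at hlower
  rw [Finset.sum_neg_distrib, Finset.sum_neg_distrib, neg_le_neg_iff] at hWsum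
  have : (∑ j ∈ mid, y j) / mid.card ≤ (∑ j ∈ U, y j) / mid.card := by gcongr
  have : (∑ j ∈ W, y j) / mid.card ≤ (∑ j ∈ mid, y j) / mid.card := by gcongr
  rw [hmean, abs_le]
  constructor <;> linarith

theorem measurable_of_iUnion_eq_univ {ι α β : Type*} [Countable ι] [MeasurableSpace α]
    [MeasurableSpace β] {s : ι → Set α} {f : α → β} {g : ι → α → β}
    (hs : ∀ i, MeasurableSet (s i)) (hcover : ⋃ i, s i = Set.univ) (hg : ∀ i, Measurable (g i))
    (hfg : ∀ i, Set.EqOn f (g i) (s i)) : Measurable f := by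
  intro t ht
  rw [← Set.univ_inter (f ⁻¹' t), ← hcover, Set.iUnion_inter]
  exact .iUnion fun i => (hfg i).inter_preimage_eq t ▸ (hs i).inter (hg i ht)

theorem measurable_trimmedMean (A : Finset (Fin V)) (f : ℕ) : Measurable (trimmedMean A f) := by
  refine measurable_of_iUnion_eq_univ
    (ι := {L : List (Fin V) // (L : Multiset (Fin V)) = A.val})
    (s := fun L => {y | L.1.Pairwise fun a b => y b ≤ y a})
    (g := fun L y => (((L.1.drop f).take (A.card - 2 * f)).map y).sum / ((A.card - 2 * f : ℕ) : ℝ))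
    (fun L => ?_) ?_ (fun L => ?_) fun L y hy => trimmedMean_eq_of_pairwise_ge L.2 hy
  · simp only [List.pairwise_iff_get, Set.ofPred_forall]
    exact .iInter fun i => .iInter fun j => .iInter fun _ =>
      measurableSet_le (measurable_pi_apply _) (measurable_pi_apply _)
  · refine Set.eq_univ_of_forall fun y => Set.mem_iUnion.mpr ?_
    obtain ⟨L, hL, hy⟩ := exists_list_pairwise_ge A y
    exact ⟨⟨L, hL⟩, hy⟩
  · have hsum : ∀ l : List (Fin V), Measurable fun y : Fin V → ℝ => (l.map y).sum := fun l => by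
      induction l with
      | nil => exact measurable_const
      | cons j l ih => simp only [List.map_cons, List.sum_cons]; fun_prop
    exact (hsum _).div_const _

end TrimmedMean

/-! ### Neighbourhoods -/

section Neighbourhood

variable {V : ℕ} (G : SimpleGraph (Fin V)) (w : ℕ)

theorem mem_nbhd {i j : Fin V} : j ∈ nbhd G w i ↔ G.dist i j ≤ w := by
  simp [nbhd]

theorem self_mem_nbhd (i : Fin V) : i ∈ nbhd G w i := by
  simp [mem_nbhd]

theorem mem_nbhd_comm {i j : Fin V} : j ∈ nbhd G w i ↔ i ∈ nbhd G w j := by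
  rw [mem_nbhd, mem_nbhd, G.dist_comm]

theorem nbhd_card_pos (i : Fin V) : 0 < (nbhd G w i).card :=
  Finset.card_pos.mpr ⟨i, self_mem_nbhd G w i⟩

theorem vLoc_le_card {i j : Fin V} (hj : j ∈ nbhd G w i) : vLoc G w i ≤ (nbhd G w j).card :=
  ciInf_le (OrderBot.bddBelow _) (⟨j, hj⟩ : {j : Fin V // j ∈ nbhd G w i})

theorem vMin_le_card (j : Fin V) : vMin G w ≤ (nbhd G w j).card :=
  ciInf_le (OrderBot.bddBelow _) j

theorem vMin_le_vLoc (i : Fin V) : vMin G w ≤ vLoc G w i :=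
  have : Nonempty {j : Fin V // j ∈ nbhd G w i} := ⟨⟨i, self_mem_nbhd G w i⟩⟩
  le_ciInf fun j => vMin_le_card G w j.1

theorem vMin_pos [Nonempty (Fin V)] : 0 < vMin G w :=
  Nat.lt_of_succ_le (le_ciInf fun j => nbhd_card_pos G w j)

theorem vLoc_pos (i : Fin V) : 0 < vLoc G w i :=
  have : Nonempty (Fin V) := ⟨i⟩
  (vMin_pos G w).trans_le (vMin_le_vLoc G w i)

theorem vLoc_le (i : Fin V) : vLoc G w i ≤ V :=
  (vLoc_le_card G w (self_mem_nbhd G w i)).trans (card_finset_fin_le _)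

end Neighbourhood

/-! ### The schedule of rounds -/

namespace Setup

variable {V K : ℕ} {P : Setup V K}

section Schedule

variable (P)

theorem start_strictMono : StrictMono P.start :=
  strictMono_nat_of_lt_succ fun m => by rw [start]; omega

theorem start_epoch_le (t : ℕ) : P.start (P.epoch t) ≤ t :=
  Nat.findGreatest_spec (P := fun m => P.start m ≤ t) (Nat.zero_le t) (Nat.zero_le t)

theorem lt_start_epoch_succ (t : ℕ) : t < P.start (P.epoch t + 1) := by
  by_contra! h
  exact (Nat.le_findGreatest (P := fun m => P.start m ≤ t)
    (P.start_strictMono.le_apply.trans h) h).not_gt (Nat.lt_succ_self _)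

variable {P}

theorem epoch_eq {m t : ℕ} (hstart : P.start m ≤ t) (hlt : t < P.start (m + 1)) :
    P.epoch t = m := by
  have := P.start_strictMono.lt_iff_lt.mp (hstart.trans_lt (P.lt_start_epoch_succ t))
  have := P.start_strictMono.lt_iff_lt.mp ((P.start_epoch_le t).trans_lt hlt)
  omega

theorem epoch_eq_of_mem_Ico {m t : ℕ} (ht : t ∈ Finset.Ico (P.start m) (P.start m + P.len m)) :
    P.epoch t = m := by
  rw [Finset.mem_Ico] at ht
  exact epoch_eq ht.1 (by rw [start]; omega)

theorem not_isComm_of_mem_Ico {m t : ℕ}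
    (ht : t ∈ Finset.Ico (P.start m) (P.start m + P.len m)) : ¬P.IsComm t := by
  rw [IsComm, epoch_eq_of_mem_Ico ht]
  exact (Finset.mem_Ico.mp ht).2.ne

variable (P)

theorem epoch_start_add_len (m : ℕ) : P.epoch (P.start m + P.len m) = m :=
  epoch_eq (Nat.le_add_right _ _) (by rw [start]; omega)

theorem isComm_start_add_len (m : ℕ) : P.IsComm (P.start m + P.len m) := by
  rw [IsComm, P.epoch_start_add_len]

theorem sum_range_start {M : Type*} [AddCommMonoid M] (φ : ℕ → M) (n : ℕ) :
    ∑ t ∈ Finset.range (P.start n), φ t = ∑ m ∈ Finset.range n,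
      (∑ t ∈ Finset.Ico (P.start m) (P.start m + P.len m), φ t + φ (P.start m + P.len m)) := by
  induction n with
  | zero => simp [start]
  | succ n ih =>
    rw [Finset.sum_range_succ, ← ih, ← Finset.sum_Ico_succ_top (by omega), Finset.range_eq_Ico,
      Finset.range_eq_Ico, Finset.sum_Ico_consecutive φ (Nat.zero_le _) (by omega), start]

theorem lam_nonneg : 0 ≤ P.lam :=
  mul_nonneg (by norm_num) (by exact_mod_cast Real.log_natCast_nonneg (2 * V * P.T))

theorem le_len (m : ℕ) :
    P.lam * K * 2 ^ (2 * m) / ((1 - 2 * P.α) * vMin P.G 1) ≤ P.len m := Nat.le_ceil _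

/-- A number of epochs that covers the horizon. -/
def numEpochs : ℕ := Nat.log 2 (V * P.T) + 1

end Schedule

namespace Admissible

variable (hP : P.Admissible)

include hP

theorem one_sub_pos : 0 < 1 - 2 * P.α := by linarith [hP.alpha_lt]

theorem one_sub_le : 1 - 2 * P.α ≤ 1 := by linarith [hP.alpha_nonneg]

theorem one_sub_mul_vLoc_pos (i : Fin V) : 0 < (1 - 2 * P.α) * vLoc P.G 1 i :=
  mul_pos hP.one_sub_pos (Nat.cast_pos.mpr (vLoc_pos P.G 1 i))

theorem one_sub_mul_vMin_pos : 0 < (1 - 2 * P.α) * vMin P.G 1 :=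
  have := hP.connected.nonempty
  mul_pos hP.one_sub_pos (Nat.cast_pos.mpr (vMin_pos P.G 1))

theorem one_sub_mul_card_pos (i : Fin V) : 0 < (1 - 2 * P.α) * (nbhd P.G 1 i).card :=
  mul_pos hP.one_sub_pos (Nat.cast_pos.mpr (nbhd_card_pos P.G 1 i))

theorem one_sub_mul_vMin_le : (1 - 2 * P.α) * vMin P.G 1 ≤ V := by
  obtain ⟨i⟩ := hP.connected.nonempty
  have hv : (vMin P.G 1 : ℝ) ≤ V := Nat.cast_le.mpr
    ((vMin_le_vLoc P.G 1 i).trans (vLoc_le P.G 1 i))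
  calc (1 - 2 * P.α) * vMin P.G 1 ≤ 1 * V := by gcongr; exact hP.one_sub_le
    _ = V := one_mul _

theorem one_le_mul (hT : 1 ≤ P.T) : (1 : ℝ) ≤ V * P.T := by
  obtain ⟨i⟩ := hP.connected.nonempty
  exact_mod_cast Nat.mul_pos i.pos hT

theorem lam_eq (hT : 1 ≤ P.T) : P.lam = 512 * (Real.log 2 + Real.log (V * P.T)) := by
  rw [lam, mul_assoc, Real.log_mul two_ne_zero (zero_lt_one.trans_le (hP.one_le_mul hT)).ne']
  norm_num

theorem le_lam (hT : 1 ≤ P.T) : 256 ≤ P.lam := by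
  rw [hP.lam_eq hT]
  linarith [Real.log_two_gt_d9, Real.log_nonneg (hP.one_le_mul hT)]

theorem len_pos [NeZero K] (hT : 1 ≤ P.T) (m : ℕ) : 0 < P.len m := by
  have := hP.le_lam hT
  have := hP.one_sub_mul_vMin_pos
  have : (1 : ℝ) ≤ K := Nat.one_le_cast.mpr NeZero.one_le
  exact Nat.ceil_pos.mpr (by positivity)

theorem horizon_lt_len [NeZero K] (hT : 1 ≤ P.T) {m : ℕ} (hm : P.numEpochs ≤ m + 1) :
    P.T < P.len m := by
  have hK : (1 : ℝ) ≤ K := Nat.one_le_cast.mpr NeZero.one_le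
  have hlam := hP.le_lam hT
  have hlog : (V : ℝ) * P.T < 2 ^ (m + 1) :=
    mod_cast (Nat.lt_pow_succ_log_self one_lt_two _).trans_le (Nat.pow_le_pow_right two_pos hm)
  have hlen : (P.T : ℝ) < P.len m := by
    refine lt_of_lt_of_le ?_ (P.le_len m)
    rw [lt_div_iff₀ hP.one_sub_mul_vMin_pos]
    calc (P.T : ℝ) * ((1 - 2 * P.α) * vMin P.G 1) ≤ P.T * V := by
          gcongr; exact hP.one_sub_mul_vMin_le
      _ = V * P.T := mul_comm _ _
      _ < 2 ^ (m + 1) := hlog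
      _ = 2 * 1 * 2 ^ m := by ring
      _ ≤ P.lam * K * 2 ^ (2 * m) := by gcongr <;> linarith
  exact_mod_cast hlen

theorem horizon_le_start [NeZero K] (hT : 1 ≤ P.T) : P.T ≤ P.start P.numEpochs := by
  have : P.T < P.len (Nat.log 2 (V * P.T)) := hP.horizon_lt_len hT le_rfl
  rw [numEpochs, start]
  omega

theorem natLog_le (hT : 1 ≤ P.T) : (Nat.log 2 (V * P.T) : ℝ) ≤ 2 * Real.log (V * P.T) := by
  have hlogb := Real.natLog_le_logb (V * P.T) 2
  push_cast at hlogb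
  refine hlogb.trans ?_
  rw [Real.logb, div_le_iff₀ (Real.log_pos one_lt_two)]
  nlinarith [Real.log_nonneg (hP.one_le_mul hT), Real.log_two_gt_d9]

open Classical in
theorem card_isComm_le [NeZero K] (hT : 1 ≤ P.T) :
    ((Finset.range P.T).filter P.IsComm).card ≤ Nat.log 2 (V * P.T) := by
  rw [← Finset.card_range (Nat.log 2 (V * P.T))]
  refine Finset.card_le_card_of_injOn P.epoch (fun t ht => ?_) fun t ht s hs hts => ?_
  · simp only [Finset.coe_filter, Finset.mem_range, IsComm, Set.mem_ofPred_eq] at ht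
    rw [Finset.coe_range, Set.mem_Iio]
    by_contra! h
    have := hP.horizon_lt_len hT (Nat.succ_le_succ h)
    omega
  · simp only [Finset.coe_filter, IsComm, Set.mem_ofPred_eq] at ht hs
    rw [ht.2, hs.2, hts]

theorem cost_le [NeZero K] (hT : 1 ≤ P.T) : (P.cost : ℝ) ≤ 2 * (V * Real.log (V * P.T)) := by
  classical
  have hcost : P.cost = V * ((Finset.range P.T).filter P.IsComm).card := by
    simp [cost]
  calc (P.cost : ℝ) ≤ V * Nat.log 2 (V * P.T) := by
        rw [hcost]
        exact_mod_cast Nat.mul_le_mul_left V (hP.card_isComm_le hT)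
    _ ≤ V * (2 * Real.log (V * P.T)) := by gcongr; exact hP.natLog_le hT
    _ = 2 * (V * Real.log (V * P.T)) := by ring

end Admissible

end Setup

/-! ### Suboptimality gaps -/

section SubGap

variable {K : ℕ} {ν : Fin K → Measure ℝ}

theorem mean_le_bestMean (ν : Fin K → Measure ℝ) (k : Fin K) : mean ν k ≤ bestMean ν :=
  le_ciSup (Set.finite_range (mean ν)).bddAbove k

theorem subGap_nonneg (ν : Fin K → Measure ℝ) (k : Fin K) : 0 ≤ subGap ν k :=
  sub_nonneg.mpr (mean_le_bestMean ν k)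

theorem exists_subGap_eq_zero [NeZero K] (ν : Fin K → Measure ℝ) : ∃ k, subGap ν k = 0 := by
  obtain ⟨k, hk⟩ := exists_eq_ciSup_of_finite (f := mean ν)
  exact ⟨k, sub_eq_zero.mpr hk.symm⟩

theorem subGap_le_one [NeZero K] (hν : ∀ k, mean ν k ∈ Set.Icc (0 : ℝ) 1) (k : Fin K) :
    subGap ν k ≤ 1 := by
  have hbest : bestMean ν ≤ 1 := ciSup_le fun l => (hν l).2
  rw [subGap]
  linarith [(hν k).1]

end SubGap

namespace Setup

variable {V K : ℕ} {P : Setup V K} {m : ℕ} {i j : Fin V}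

/-! ### Intended numbers of pulls -/

section Alloc

theorem alloc_lead (P : Setup V K) (m : ℕ) (i : Fin V) (Δ : Fin K → ℝ) :
    P.alloc m i Δ (P.lead m i Δ) =
      P.len m - ∑ l ∈ Finset.univ.erase (P.lead m i Δ), P.baseAlloc m i (Δ l) := by
  rw [alloc, if_pos rfl]

theorem alloc_of_ne {Δ : Fin K → ℝ} {k : Fin K} (hk : k ≠ P.lead m i Δ) :
    P.alloc m i Δ k = P.baseAlloc m i (Δ k) := by
  rw [alloc, if_neg hk]

theorem sum_alloc (P : Setup V K) (m : ℕ) (i : Fin V) (Δ : Fin K → ℝ) :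
    ∑ k, P.alloc m i Δ k = P.len m := by
  classical
  rw [← Finset.add_sum_erase _ _ (Finset.mem_univ (P.lead m i Δ)), alloc_lead,
    Finset.sum_congr rfl fun l hl => alloc_of_ne (Finset.ne_of_mem_erase hl), sub_add_cancel]

/-- The number of pulls below which agent `i` discards a message about an arm with gap
estimate `δ`. -/
noncomputable def threshold (P : Setup V K) (i : Fin V) (δ : ℝ) : ℝ :=
  P.lam * (δ ^ 2)⁻¹ / ((1 - 2 * P.α) * (nbhd P.G 1 i).card)

namespace Admissible

variable (hP : P.Admissible)

include hP

theorem baseAlloc_nonneg (m : ℕ) (i : Fin V) (δ : ℝ) : 0 ≤ P.baseAlloc m i δ := by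
  have := P.lam_nonneg
  have := hP.one_sub_mul_vLoc_pos i
  exact le_min (by positivity) (by positivity)

theorem sum_baseAlloc_le_len (m : ℕ) (i : Fin V) (Δ : Fin K → ℝ) :
    ∑ k, P.baseAlloc m i (Δ k) ≤ P.len m := by
  have hlam := P.lam_nonneg
  have hα := hP.one_sub_pos
  have hvMin := hP.one_sub_mul_vMin_pos
  have hv : (vMin P.G 1 : ℝ) ≤ vLoc P.G 1 i := Nat.cast_le.mpr (vMin_le_vLoc P.G 1 i)
  calc ∑ k, P.baseAlloc m i (Δ k)
      ≤ ∑ _k : Fin K, P.lam * 2 ^ (2 * m) / ((1 - 2 * P.α) * vLoc P.G 1 i) :=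
        Finset.sum_le_sum fun k _ => min_le_right _ _
    _ = P.lam * K * 2 ^ (2 * m) / ((1 - 2 * P.α) * vLoc P.G 1 i) := by
        rw [Finset.sum_const, Finset.card_univ, Fintype.card_fin, nsmul_eq_mul]
        ring
    _ ≤ P.lam * K * 2 ^ (2 * m) / ((1 - 2 * P.α) * vMin P.G 1) := by gcongr
    _ ≤ P.len m := P.le_len m

theorem baseAlloc_le_alloc (m : ℕ) (i : Fin V) (Δ : Fin K → ℝ) (k : Fin K) :
    P.baseAlloc m i (Δ k) ≤ P.alloc m i Δ k := by
  classical
  obtain rfl | hk := eq_or_ne k (P.lead m i Δ)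
  · rw [alloc_lead, le_sub_iff_add_le,
      Finset.add_sum_erase _ (fun l => P.baseAlloc m i (Δ l)) (Finset.mem_univ _)]
    exact hP.sum_baseAlloc_le_len m i Δ
  · exact (alloc_of_ne hk).ge

theorem alloc_nonneg (m : ℕ) (i : Fin V) (Δ : Fin K → ℝ) (k : Fin K) : 0 ≤ P.alloc m i Δ k :=
  (hP.baseAlloc_nonneg m i _).trans (hP.baseAlloc_le_alloc m i Δ k)

theorem threshold_le_baseAlloc (hij : j ∈ nbhd P.G 1 i) {δ δ' : ℝ} (hδ : (1 / 2) ^ m ≤ δ)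
    (hδ' : 0 < δ') (h : δ' ≤ 4 * δ) : P.threshold i δ ≤ P.baseAlloc m j δ' := by
  have hlam := P.lam_nonneg
  have hvLoc := hP.one_sub_mul_vLoc_pos j
  have hcard : (vLoc P.G 1 j : ℝ) ≤ (nbhd P.G 1 i).card :=
    Nat.cast_le.mpr (vLoc_le_card P.G 1 ((mem_nbhd_comm P.G 1).mp hij))
  have hα := hP.one_sub_pos
  have hpow : (0 : ℝ) < (1 / 2) ^ m := by positivity
  have hδ0 : 0 < δ := hpow.trans_le hδ
  rw [threshold]
  refine le_min ?_ ?_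
  · have hinv : (δ ^ 2)⁻¹ ≤ 16 * (δ' ^ 2)⁻¹ := by
      rw [← div_eq_mul_inv, inv_eq_one_div, div_le_div_iff₀ (by positivity) (by positivity)]
      nlinarith
    calc P.lam * (δ ^ 2)⁻¹ / ((1 - 2 * P.α) * (nbhd P.G 1 i).card)
        ≤ P.lam * (16 * (δ' ^ 2)⁻¹) / ((1 - 2 * P.α) * vLoc P.G 1 j) := by gcongr
      _ = 16 * P.lam * (δ' ^ 2)⁻¹ / ((1 - 2 * P.α) * vLoc P.G 1 j) := by ring
  · have hinv : (δ ^ 2)⁻¹ ≤ 2 ^ (2 * m) :=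
      calc (δ ^ 2)⁻¹ ≤ (((1 / 2 : ℝ) ^ m) ^ 2)⁻¹ := by gcongr
        _ = 2 ^ (2 * m) := by rw [← pow_mul, mul_comm m 2, ← inv_pow]; norm_num
    gcongr

end Admissible

end Alloc

/-! ### Gap estimates -/

section Gap

variable [NeZero K] {ξ : Path V K} {ν : Fin K → Measure ℝ}

/-- The number of pulls of arm `k` that agent `i` announces at the end of epoch `m`. -/
noncomputable def pulls (P : Setup V K) (ξ : Path V K) (m : ℕ) (i : Fin V) (k : Fin K) : ℝ :=
  P.alloc m i (P.gap ξ m i) k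

/-- The empirical mean of arm `k` that agent `i` announces at the end of epoch `m`. -/
noncomputable def empMean (P : Setup V K) (ξ : Path V K) (m : ℕ) (i : Fin V) (k : Fin K) : ℝ :=
  P.rewardSum m i (P.gap ξ m i) ξ k / P.pulls ξ m i k

/-- `r^m_{i,k}`: the mean of arm `k` as estimated by agent `i` at the end of epoch `m`. -/
noncomputable def armEstimate (P : Setup V K) (ξ : Path V K) (m : ℕ) (i : Fin V) (k : Fin K) :
    ℝ :=
  P.estimate i (P.gap ξ m i k) (fun j => P.message m (P.gap ξ m) ξ j i) k

theorem gap_succ (P : Setup V K) (ξ : Path V K) (m : ℕ) (i : Fin V) (k : Fin K) :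
    P.gap ξ (m + 1) i k = max ((1 / 2) ^ (m + 1))
      ((⨆ l, (P.armEstimate ξ m i l - P.gap ξ m i l / 8)) - P.armEstimate ξ m i k) := rfl

theorem message_of_notMem (hj : j ∉ P.byz) :
    P.message m (P.gap ξ m) ξ j i = (P.rewardSum m j (P.gap ξ m j) ξ, P.pulls ξ m j) := by
  rw [message, if_neg hj]
  rfl

theorem le_gap (P : Setup V K) (ξ : Path V K) (m : ℕ) (i : Fin V) (k : Fin K) :
    (1 / 2) ^ m ≤ P.gap ξ m i k := by
  cases m with
  | zero => simp [gap]
  | succ m => exact le_max_left _ _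

theorem gap_pos (P : Setup V K) (ξ : Path V K) (m : ℕ) (i : Fin V) (k : Fin K) :
    0 < P.gap ξ m i k := lt_of_lt_of_le (by positivity) (P.le_gap ξ m i k)

theorem exists_gap_eq (P : Setup V K) (ξ : Path V K) (m : ℕ) (i : Fin V) :
    ∃ k, P.gap ξ m i k = (1 / 2) ^ m := by
  cases m with
  | zero => exact ⟨0, by simp [gap]⟩
  | succ m =>
    obtain ⟨l, hl⟩ := exists_eq_ciSup_of_finite
      (f := fun l => P.armEstimate ξ m i l - P.gap ξ m i l / 8)
    refine ⟨l, max_eq_left ?_⟩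
    have := P.gap_pos ξ m i l
    have : (0 : ℝ) < (1 / 2) ^ (m + 1) := by positivity
    change (⨆ l, (P.armEstimate ξ m i l - P.gap ξ m i l / 8)) - P.armEstimate ξ m i l ≤ _
    linarith

/-- In epoch `m`, sufficiently many agents with sufficiently many pulls have an accurate
average of empirical means. -/
def Accurate (P : Setup V K) (ν : Fin K → Measure ℝ) (ξ : Path V K) (m : ℕ) : Prop :=
  ∀ (i : Fin V) (k : Fin K) (W : Finset (Fin V)),
    (∀ j ∈ W, P.threshold i (P.gap ξ m i k) ≤ P.pulls ξ m j k) →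
    (1 - 2 * P.α) * (nbhd P.G 1 i).card ≤ W.card → P.gap ξ m i k ≤ 4 →
    |(∑ j ∈ W, P.empMean ξ m j k) / W.card - mean ν k| ≤ P.gap ξ m i k / 8

/-- At the start of epoch `m`, the gap estimates of all normal agents are correct up to constant
factors and the resolution `2⁻ᵐ`. -/
def GapBounds (P : Setup V K) (ν : Fin K → Measure ℝ) (ξ : Path V K) (m : ℕ) : Prop :=
  ∀ i ∉ P.byz, ∀ k,
    P.gap ξ m i k ≤ 8 / 7 * subGap ν k + (1 / 2) ^ m ∧ 24 / 49 * subGap ν k ≤ P.gap ξ m i k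

namespace Admissible

variable (hP : P.Admissible)

include hP

theorem gap_lead (ξ : Path V K) (m : ℕ) (i : Fin V) :
    P.gap ξ m i (P.lead m i (P.gap ξ m i)) = (1 / 2) ^ m := by
  classical
  obtain ⟨k, hk⟩ := P.exists_gap_eq ξ m i
  exact (Finset.mem_filter.mp (hP.sel_mem m i {k | P.gap ξ m i k = (1 / 2) ^ m}
    ⟨k, Finset.mem_filter.mpr ⟨Finset.mem_univ k, hk⟩⟩)).2

theorem threshold_le_pulls (hgap : P.GapBounds ν ξ m) (hi : i ∉ P.byz)
    (hj : j ∈ nbhd P.G 1 i \ P.byz) (k : Fin K) :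
    P.threshold i (P.gap ξ m i k) ≤ P.pulls ξ m j k := by
  rw [Finset.mem_sdiff] at hj
  refine (hP.threshold_le_baseAlloc hj.1 (P.le_gap ξ m i k) (P.gap_pos ξ m j k) ?_).trans
    (hP.baseAlloc_le_alloc m j (P.gap ξ m j) k)
  linarith [(hgap i hi k).2, (hgap j hj.2 k).1, P.le_gap ξ m i k, P.gap_pos ξ m i k]

end Admissible

end Gap

/-! ### The filter -/

section Filter

/-- The number of values that the filter of agent `i` removes at either end, when the messages
of `c` neighbours are left. -/
noncomputable def trim (P : Setup V K) (i : Fin V) (c : ℕ) : ℕ :=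
  ⌊((c : ℝ) - (1 - 2 * P.α) * (nbhd P.G 1 i).card) / 2⌋₊

/-- The neighbours of `i` whose messages about arm `k` contain enough pulls. -/
noncomputable def passing (P : Setup V K) (i : Fin V) (δ : ℝ) (msg : Fin V → Message K)
    (k : Fin K) : Finset (Fin V) :=
  open Classical in (nbhd P.G 1 i).filter fun j => P.threshold i δ ≤ (msg j).2 k

theorem mem_passing {δ : ℝ} {msg : Fin V → Message K} {k : Fin K} :
    j ∈ P.passing i δ msg k ↔ j ∈ nbhd P.G 1 i ∧ P.threshold i δ ≤ (msg j).2 k :=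
  Finset.mem_filter

theorem estimate_of_le_card {δ : ℝ} {msg : Fin V → Message K} {k : Fin K}
    (h : (1 - 2 * P.α) * (nbhd P.G 1 i).card ≤ (P.passing i δ msg k).card) :
    P.estimate i δ msg k = min (trimmedMean (P.passing i δ msg k)
      (P.trim i (P.passing i δ msg k).card) fun j => (msg j).1 k / (msg j).2 k) 1 := by
  unfold passing threshold at h ⊢
  simp only [estimate, if_neg h.not_gt]
  rfl

theorem le_card_sub_two_mul_trim {c : ℕ} (hc : (1 - 2 * P.α) * (nbhd P.G 1 i).card ≤ c) :
    (1 - 2 * P.α) * (nbhd P.G 1 i).card ≤ c - 2 * P.trim i c := by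
  have htrim : (P.trim i c : ℝ) ≤ (c - (1 - 2 * P.α) * (nbhd P.G 1 i).card) / 2 :=
    Nat.floor_le (by linarith)
  linarith

variable (hP : P.Admissible) (hi : i ∉ P.byz)

include hP hi

theorem Admissible.le_card_sdiff_byz :
    (1 - P.α) * (nbhd P.G 1 i).card ≤ (nbhd P.G 1 i \ P.byz).card := by
  have hcard : ((nbhd P.G 1 i \ P.byz).card : ℝ) + (P.byz ∩ nbhd P.G 1 i).card =
      (nbhd P.G 1 i).card := by
    rw [Finset.inter_comm]
    exact_mod_cast Finset.card_sdiff_add_card_inter (nbhd P.G 1 i) P.byz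
  linarith [hP.byz_fraction i hi]

variable {A : Finset (Fin V)} (hA : nbhd P.G 1 i \ P.byz ⊆ A)

include hA

theorem Admissible.le_card : (1 - 2 * P.α) * (nbhd P.G 1 i).card ≤ A.card := by
  have hnormal := hP.le_card_sdiff_byz hi
  have hle : ((nbhd P.G 1 i \ P.byz).card : ℝ) ≤ A.card := Nat.cast_le.mpr (Finset.card_le_card hA)
  have := mul_nonneg hP.alpha_nonneg (Nat.cast_nonneg (α := ℝ) (nbhd P.G 1 i).card)
  linarith

theorem Admissible.card_sdiff_le_trim (hAN : A ⊆ nbhd P.G 1 i) :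
    (A \ (nbhd P.G 1 i \ P.byz)).card ≤ P.trim i A.card := by
  have hnormal := hP.le_card_sdiff_byz hi
  have hcard : ((A \ (nbhd P.G 1 i \ P.byz)).card : ℝ) + (nbhd P.G 1 i \ P.byz).card = A.card := by
    exact_mod_cast Finset.card_sdiff_add_card_eq_card hA
  have hle : (A.card : ℝ) ≤ (nbhd P.G 1 i).card := Nat.cast_le.mpr (Finset.card_le_card hAN)
  exact Nat.le_floor (by linarith)

end Filter

section GapBounds

variable [NeZero K] {ξ : Path V K} {ν : Fin K → Measure ℝ} (hP : P.Admissible)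

include hP

theorem Admissible.exists_armEstimate_eq (hgap : P.GapBounds ν ξ m) (hi : i ∉ P.byz) (k : Fin K) :
    ∃ A, nbhd P.G 1 i \ P.byz ⊆ A ∧ A ⊆ nbhd P.G 1 i ∧
      P.armEstimate ξ m i k = min (trimmedMean A (P.trim i A.card) fun j =>
        (P.message m (P.gap ξ m) ξ j i).1 k / (P.message m (P.gap ξ m) ξ j i).2 k) 1 := by
  have hA : nbhd P.G 1 i \ P.byz ⊆
      P.passing i (P.gap ξ m i k) (fun j => P.message m (P.gap ξ m) ξ j i) k := by
    intro j hj
    rw [mem_passing, message_of_notMem (Finset.mem_sdiff.mp hj).2]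
    exact ⟨(Finset.mem_sdiff.mp hj).1, hP.threshold_le_pulls hgap hi hj k⟩
  exact ⟨_, hA, fun j hj => (mem_passing.mp hj).1, estimate_of_le_card (hP.le_card hi hA)⟩

theorem Admissible.abs_armEstimate_sub_le (hν : ∀ k, mean ν k ∈ Set.Icc (0 : ℝ) 1)
    (hacc : P.Accurate ν ξ m) (hgap : P.GapBounds ν ξ m) (hi : i ∉ P.byz) (k : Fin K) :
    |P.armEstimate ξ m i k - mean ν k| ≤ P.gap ξ m i k / 8 := by
  have hgap_le : P.gap ξ m i k ≤ 4 := by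
    have hpow : (1 / 2 : ℝ) ^ m ≤ 1 := pow_le_one₀ (by norm_num) (by norm_num)
    linarith [(hgap i hi k).1, subGap_le_one hν k]
  obtain ⟨A, hA, hAN, hest⟩ := hP.exists_armEstimate_eq hgap hi k
  have hkept := le_card_sub_two_mul_trim (hP.le_card hi hA)
  have htrim : 2 * P.trim i A.card ≤ A.card := by
    have := hP.one_sub_mul_card_pos i
    exact_mod_cast (by linarith : (2 : ℝ) * P.trim i A.card ≤ A.card)
  have hmean := abs_trimmedMean_sub_le htrim (hP.card_sdiff_le_trim hi hA hAN)
    (c := mean ν k) (ε := P.gap ξ m i k / 8) fun W hW hWcard => by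
      have hsum : ∑ j ∈ W, (P.message m (P.gap ξ m) ξ j i).1 k /
          (P.message m (P.gap ξ m) ξ j i).2 k = ∑ j ∈ W, P.empMean ξ m j k :=
        Finset.sum_congr rfl fun j hj => by
          rw [message_of_notMem (Finset.mem_sdiff.mp (hW hj)).2, empMean]
      rw [hsum]
      refine hacc i k W (fun j hj => hP.threshold_le_pulls hgap hi (hW hj) k) ?_ hgap_le
      rw [hWcard, Nat.cast_sub htrim]
      exact_mod_cast hkept
  rw [abs_le] at hmean ⊢
  rw [hest, neg_le_sub_iff_le_add, sub_le_iff_le_add]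
  refine ⟨?_, (min_le_left _ _).trans (by linarith)⟩
  rw [← sub_le_iff_le_add]
  exact le_min (by linarith) (by linarith [(hν k).2, P.gap_pos ξ m i k])

variable (hν : ∀ k, mean ν k ∈ Set.Icc (0 : ℝ) 1)

include hν

theorem Admissible.gapBounds_succ (hacc : P.Accurate ν ξ m) (hgap : P.GapBounds ν ξ m) :
    P.GapBounds ν ξ (m + 1) := by
  intro i hi k
  have hest := fun l => abs_le.mp (hP.abs_armEstimate_sub_le hν hacc hgap hi l)
  have hsup_le : ⨆ l, (P.armEstimate ξ m i l - P.gap ξ m i l / 8) ≤ bestMean ν :=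
    ciSup_le fun l => by linarith [(hest l).2, mean_le_bestMean ν l]
  have hle_sup : bestMean ν - (1 / 2) ^ m / 4 ≤
      ⨆ l, (P.armEstimate ξ m i l - P.gap ξ m i l / 8) := by
    obtain ⟨b, hb⟩ := exists_subGap_eq_zero ν
    refine le_ciSup_of_le (Set.finite_range _).bddAbove b ?_
    have hgap_b := (hgap i hi b).1
    rw [hb] at hgap_b
    rw [subGap] at hb
    linarith [(hest b).1]
  have hpow : (0 : ℝ) < (1 / 2) ^ m := by positivity
  have hpow_succ : (1 / 2 : ℝ) ^ (m + 1) = (1 / 2) ^ m / 2 := by rw [pow_succ]; ring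
  rw [P.gap_succ, hpow_succ]
  have hk := hest k
  have hgap_k := (hgap i hi k).1
  have hD := subGap_nonneg ν k
  have hDk : subGap ν k = bestMean ν - mean ν k := rfl
  refine ⟨max_le (by linarith) (by linarith), ?_⟩
  -- `4/7` and `3/7` are the weights for which the powers of `1/2` cancel.
  calc 24 / 49 * subGap ν k
      ≤ 3 / 7 * ((1 / 2) ^ m / 2) + 4 / 7 *
        ((⨆ l, (P.armEstimate ξ m i l - P.gap ξ m i l / 8)) - P.armEstimate ξ m i k) := by
        linarith
    _ ≤ _ := by
        linarith [le_max_left ((1 / 2 : ℝ) ^ m / 2)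
          ((⨆ l, (P.armEstimate ξ m i l - P.gap ξ m i l / 8)) - P.armEstimate ξ m i k),
          le_max_right ((1 / 2 : ℝ) ^ m / 2)
          ((⨆ l, (P.armEstimate ξ m i l - P.gap ξ m i l / 8)) - P.armEstimate ξ m i k)]

theorem Admissible.gapBounds (hacc : ∀ m' < m, P.Accurate ν ξ m') : P.GapBounds ν ξ m := by
  induction m with
  | zero =>
    intro i _ k
    have := subGap_nonneg ν k
    have := subGap_le_one hν k
    simp only [gap, pow_zero]
    constructor <;> linarith
  | succ m ih =>
    exact hP.gapBounds_succ hν (hacc m (Nat.lt_succ_self m))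
      (ih fun m' h => hacc m' (h.trans (Nat.lt_succ_self m)))

end GapBounds

end Setup

/-! ### Measurability of the algorithm -/

section Measurability

variable {V K : ℕ} [NeZero K]

theorem measurable_draw : Measurable fun q : (Fin K → ℝ) × ℝ => draw q.1 q.2 := by
  classical
  have hset : Measurable fun q : (Fin K → ℝ) × ℝ =>
      Finset.univ.filter fun k => q.2 < ∑ l ∈ Finset.Iic k, q.1 l := by
    refine measurable_finset_iff.mpr fun k => ?_
    simp only [Finset.mem_filter, Finset.mem_univ, true_and]
    exact (measurableSet_lt measurable_snd (by fun_prop)).mem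
  exact (measurable_of_countable fun S : Finset (Fin K) =>
    if h : S.Nonempty then S.min' h else 0).comp hset

/-- The reward from arm `k` of an agent that draws its arm from `p`, where `y` consists of the
seed and the reward vector. -/
noncomputable def gain (p : Fin K → ℝ) (k : Fin K) (y : ℝ × (Fin K → ℝ)) : ℝ :=
  if draw p y.1 = k then y.2 k else 0

theorem measurable_gain (k : Fin K) :
    Measurable fun q : (Fin K → ℝ) × ℝ × (Fin K → ℝ) => gain q.1 k q.2 :=
  Measurable.ite
    ((measurable_draw.comp (measurable_fst.prodMk measurable_snd.fst)) (measurableSet_singleton k))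
    ((measurable_pi_apply k).comp measurable_snd.snd) measurable_const

namespace Setup

variable (P : Setup V K)

omit [NeZero K] in
theorem measurable_lead (m : ℕ) (i : Fin V) : Measurable (P.lead m i) := by
  classical
  have hset : Measurable fun Δ : Fin K → ℝ =>
      Finset.univ.filter fun k => Δ k = (1 / 2) ^ m := by
    refine measurable_finset_iff.mpr fun k => ?_
    simp only [Finset.mem_filter, Finset.mem_univ, true_and]
    exact (measurableSet_eq_fun (measurable_pi_apply k) measurable_const).mem
  exact (measurable_of_countable (P.sel m i)).comp hset

omit [NeZero K] in
theorem measurable_baseAlloc (m : ℕ) (i : Fin V) : Measurable (P.baseAlloc m i) := by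
  unfold baseAlloc
  fun_prop

omit [NeZero K] in
theorem measurable_alloc (m : ℕ) (i : Fin V) : Measurable (P.alloc m i) := by
  classical
  refine measurable_pi_lambda _ fun k => ?_
  have hbase : ∀ l, Measurable fun Δ : Fin K → ℝ => P.baseAlloc m i (Δ l) := fun l =>
    (P.measurable_baseAlloc m i).comp (measurable_pi_apply l)
  have halloc : (fun Δ => P.alloc m i Δ k) = fun Δ =>
      if k = P.lead m i Δ then P.len m - ∑ l ∈ Finset.univ.erase k, P.baseAlloc m i (Δ l)
      else P.baseAlloc m i (Δ k) := by
    funext Δ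
    by_cases hk : k = P.lead m i Δ
    · rw [alloc, if_pos hk, if_pos hk, ← hk]
    · rw [alloc, if_neg hk, if_neg hk]
  rw [halloc]
  exact Measurable.ite (measurableSet_eq_fun measurable_const (P.measurable_lead m i))
    (measurable_const.sub (Finset.measurable_sum _ fun l _ => hbase l)) (hbase k)

/-- The probability vector `p^m_i` from which agent `i` draws its arms in the exploration rounds
of epoch `m`. -/
noncomputable def pullProb (P : Setup V K) (m : ℕ) (i : Fin V) (Δ : Fin K → ℝ) (k : Fin K) : ℝ :=
  P.alloc m i Δ k / P.len m

omit [NeZero K] in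
theorem measurable_pullProb (m : ℕ) (i : Fin V) : Measurable (P.pullProb m i) :=
  measurable_pi_lambda _ fun k =>
    ((measurable_pi_apply k).comp (P.measurable_alloc m i)).div_const _

theorem rewardSum_eq_sum_gain (m : ℕ) (i : Fin V) (Δ : Fin K → ℝ) (ξ : Path V K) (k : Fin K) :
    P.rewardSum m i Δ ξ k = ∑ t ∈ Finset.Ico (P.start m) (P.start m + P.len m),
      gain (P.pullProb m i Δ) k (ξ.u t i, ξ.x t i) := rfl

omit [NeZero K] in
theorem measurable_passing (i : Fin V) (k : Fin K) :
    Measurable fun q : ℝ × (Fin V → Message K) => P.passing i q.1 q.2 k := by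
  refine measurable_finset_iff.mpr fun j => ?_
  simp only [mem_passing, threshold]
  have hle : MeasurableSet {q : ℝ × (Fin V → Message K) |
      P.lam * (q.1 ^ 2)⁻¹ / ((1 - 2 * P.α) * (nbhd P.G 1 i).card) ≤ (q.2 j).2 k} :=
    measurableSet_le (by fun_prop) (by fun_prop)
  exact measurable_const.and hle.mem

omit [NeZero K] in
theorem measurable_estimate (i : Fin V) (k : Fin K) :
    Measurable fun q : ℝ × (Fin V → Message K) => P.estimate i q.1 q.2 k := by
  classical
  let kept (S : Finset (Fin V)) : Finset (Fin V) :=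
    if (S.card : ℝ) < (1 - 2 * P.α) * (nbhd P.G 1 i).card then nbhd P.G 1 i else S
  have hmean : Measurable fun q : Finset (Fin V) × (Fin V → ℝ) =>
      min (trimmedMean (kept q.1) (P.trim i (kept q.1).card) q.2) 1 := by
    refine Measurable.min ?_ measurable_const
    exact measurable_from_prod_countable_right fun S =>
      measurable_trimmedMean (kept S) (P.trim i (kept S).card)
  have hratio : Measurable fun q : ℝ × (Fin V → Message K) =>
      fun j => (q.2 j).1 k / (q.2 j).2 k := by fun_prop
  exact (hmean.comp ((P.measurable_passing i k).prodMk hratio) :)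

variable {Ω : Type*} [MeasurableSpace Ω] {ξ : Ω → Path V K}

theorem measurable_rewardSum {m : ℕ} {i : Fin V} {D : Ω → Fin K → ℝ} (hD : Measurable D)
    (hu : ∀ t < P.start (m + 1), Measurable fun ω => (ξ ω).u t i)
    (hx : ∀ t < P.start (m + 1), Measurable fun ω => (ξ ω).x t i) :
    Measurable fun ω => P.rewardSum m i (D ω) (ξ ω) := by
  refine measurable_pi_lambda _ fun k => ?_
  simp only [rewardSum_eq_sum_gain]
  refine Finset.measurable_sum _ fun t ht => ?_
  have hlt : t < P.start (m + 1) := by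
    rw [Finset.mem_Ico] at ht
    rw [start]
    omega
  exact ((measurable_gain k).comp
    (((P.measurable_pullProb m i).comp hD).prodMk ((hu t hlt).prodMk (hx t hlt))) :)

theorem measurable_gap {m : ℕ} (hu : ∀ t < P.start m, ∀ i, Measurable fun ω => (ξ ω).u t i)
    (hx : ∀ t < P.start m, ∀ i, Measurable fun ω => (ξ ω).x t i)
    (hz : ∀ l < m, ∀ j i, Measurable fun ω => (ξ ω).z l j i) :
    Measurable fun ω => P.gap (ξ ω) m := by
  induction m with
  | zero => exact measurable_const
  | succ m ih =>
    have hlt : P.start m < P.start (m + 1) := P.start_strictMono (Nat.lt_succ_self m)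
    have hgap := ih (fun t ht => hu t (ht.trans hlt)) (fun t ht => hx t (ht.trans hlt))
      fun l hl => hz l (hl.trans (Nat.lt_succ_self m))
    have hgap_i : ∀ i, Measurable fun ω => P.gap (ξ ω) m i := measurable_pi_iff.mp hgap
    have hgap_ik : ∀ i k, Measurable fun ω => P.gap (ξ ω) m i k := fun i =>
      measurable_pi_iff.mp (hgap_i i)
    have hmsg : ∀ j i, Measurable fun ω => P.message m (P.gap (ξ ω) m) (ξ ω) j i := by
      intro j i
      by_cases hj : j ∈ P.byz
      · simpa only [message, if_pos hj] using hz m (Nat.lt_succ_self m) j i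
      · simp only [message, if_neg hj]
        exact (P.measurable_rewardSum (hgap_i j) (hu · · j) (hx · · j)).prodMk
          ((P.measurable_alloc m j).comp (hgap_i j))
    have hest : ∀ i k, Measurable fun ω => P.armEstimate (ξ ω) m i k := fun i k =>
      ((P.measurable_estimate i k).comp
        ((hgap_ik i k).prodMk (measurable_pi_lambda _ fun j => hmsg j i)) :)
    refine measurable_pi_lambda _ fun i => measurable_pi_lambda _ fun k => ?_
    simp only [gap_succ]
    exact measurable_const.max ((Measurable.iSup fun l =>
      (hest i l).sub ((hgap_ik i l).div_const 8)).sub (hest i k))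

variable {P} {ν : Fin K → Measure ℝ} {Q : Measure Ω} (E : P.Environment ν Q)

theorem Environment.measurable_gap (m : ℕ) :
    Measurable[E.ℱ (P.start m)] fun ω => P.gap (E.path ω) m :=
  @Setup.measurable_gap V K _ P Ω (E.ℱ (P.start m)) E.path m
    (fun t ht i => (E.measurable_u t i).mono (E.ℱ.mono ht) le_rfl)
    (fun t ht i => (E.measurable_x t i).mono (E.ℱ.mono ht) le_rfl)
    fun l hl j i => (E.measurable_z l j i).mono
      (E.ℱ.mono (P.start_strictMono.monotone hl)) le_rfl

end Setup

end Measurability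

/-! ### One round of one agent -/

section Draw

variable {K : ℕ} [NeZero K] {p : Fin K → ℝ} (hp : p ∈ stdSimplex ℝ (Fin K))

include hp

omit [NeZero K] in
theorem sum_Iio_le_iff {u : ℝ} (hu : 0 ≤ u) (k : Fin K) :
    ∑ l ∈ Finset.Iio k, p l ≤ u ↔ ∀ b, u < ∑ l ∈ Finset.Iic b, p l → k ≤ b := by
  constructor
  · intro h b hb
    by_contra! hbk
    have hsub : Finset.Iic b ⊆ Finset.Iio k := fun a ha =>
      Finset.mem_Iio.mpr ((Finset.mem_Iic.mp ha).trans_lt hbk)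
    linarith [Finset.sum_le_sum_of_subset_of_nonneg hsub fun a _ _ => hp.1 a]
  · intro h
    by_cases hk : IsMin k
    · rwa [Finset.Iio_eq_empty.mpr hk, Finset.sum_empty]
    · by_contra! hlt
      rw [← Finset.Iic_pred_eq_Iio_of_not_isMin hk] at hlt
      exact (h _ hlt).not_gt (Order.pred_lt_of_not_isMin hk)

theorem draw_eq_iff {u : ℝ} (hu : u ∈ Set.Ico (0 : ℝ) 1) (k : Fin K) :
    draw p u = k ↔ u ∈ Set.Ico (∑ l ∈ Finset.Iio k, p l) (∑ l ∈ Finset.Iic k, p l) := by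
  classical
  have hne : (Finset.univ.filter fun k => u < ∑ l ∈ Finset.Iic k, p l).Nonempty :=
    ⟨⊤, by simp [hp.2, hu.2]⟩
  have hdraw : draw p u = (Finset.univ.filter fun k => u < ∑ l ∈ Finset.Iic k, p l).min' hne := by
    rw [draw, dif_pos hne]
  rw [hdraw, Finset.min'_eq_iff, Set.mem_Ico, sum_Iio_le_iff hp hu.1, and_comm]
  simp only [Finset.mem_filter, Finset.mem_univ, true_and]

theorem setIntegral_draw_eq (k : Fin K) :
    ∫ u in Set.Icc (0 : ℝ) 1, (if draw p u = k then (1 : ℝ) else 0) = p k := by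
  set a := ∑ l ∈ Finset.Iio k, p l
  set b := ∑ l ∈ Finset.Iic k, p l
  have hab : b = p k + a := by
    simp only [a, b]
    rw [← Finset.Iio_insert, Finset.sum_insert (by simp)]
  have ha : 0 ≤ a := Finset.sum_nonneg fun l _ => hp.1 l
  have hb : b ≤ 1 := hp.2 ▸
    Finset.sum_le_sum_of_subset_of_nonneg (Finset.subset_univ _) fun l _ _ => hp.1 l
  have hind : ∀ u ∈ Set.Ico (0 : ℝ) 1, (if draw p u = k then (1 : ℝ) else 0) =
      (Set.Ico a b).indicator (fun _ => 1) u := fun u hu => by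
    simp only [Set.indicator_apply, draw_eq_iff hp hu, a, b]
  rw [integral_Icc_eq_integral_Ico, setIntegral_congr_fun measurableSet_Ico hind,
    setIntegral_indicator measurableSet_Ico,
    Set.inter_eq_self_of_subset_right (Set.Ico_subset_Ico ha hb)]
  simp [hab, hp.1 k]

end Draw

theorem draw_single {K : ℕ} [NeZero K] {u : ℝ} (hu : u ∈ Set.Ico (0 : ℝ) 1) (k : Fin K) :
    draw (Pi.single k 1) u = k := by
  rw [draw_eq_iff (single_mem_stdSimplex ℝ k) hu, Finset.sum_pi_single', Finset.sum_pi_single']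
  simpa using hu

section AgentLaw

variable {K : ℕ} {ν : Fin K → Measure ℝ}

instance : IsProbabilityMeasure (volume.restrict (Set.Icc (0 : ℝ) 1)) := ⟨by simp⟩

/-- The joint law of the seed and the reward vector of one agent in one round. -/
noncomputable abbrev agentLaw (ν : Fin K → Measure ℝ) : Measure (ℝ × (Fin K → ℝ)) :=
  (volume.restrict (Set.Icc (0 : ℝ) 1)).prod (Measure.pi ν)

theorem sum_gain [NeZero K] (p : Fin K → ℝ) (y : ℝ × (Fin K → ℝ)) :
    ∑ k, gain p k y = y.2 (draw p y.1) := by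
  simp [gain]

theorem gain_mem_Icc [NeZero K] (p : Fin K → ℝ) (k : Fin K) {y : ℝ × (Fin K → ℝ)}
    (hy : ∀ k, y.2 k ∈ Set.Icc (0 : ℝ) 1) : gain p k y ∈ Set.Icc (0 : ℝ) 1 := by
  rw [gain]
  split_ifs
  exacts [hy k, ⟨le_rfl, zero_le_one⟩]

variable [∀ k, IsProbabilityMeasure (ν k)]

theorem ae_agentLaw (hν : ∀ k, ∀ᵐ y ∂(ν k), y ∈ Set.Icc (0 : ℝ) 1) :
    ∀ᵐ y ∂(agentLaw ν), y.1 ∈ Set.Ico (0 : ℝ) 1 ∧ ∀ k, y.2 k ∈ Set.Icc (0 : ℝ) 1 := by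
  have hseed : ∀ᵐ u ∂volume.restrict (Set.Icc (0 : ℝ) 1), u ∈ Set.Ico (0 : ℝ) 1 := by
    rw [← restrict_Ico_eq_restrict_Icc]
    exact ae_restrict_mem measurableSet_Ico
  have hreward : ∀ᵐ x ∂(Measure.pi ν), ∀ k, x k ∈ Set.Icc (0 : ℝ) 1 :=
    ae_all_iff.mpr fun k => (measurePreserving_eval ν k).quasiMeasurePreserving.ae (hν k)
  exact (Measure.quasiMeasurePreserving_fst.ae hseed).and
    (Measure.quasiMeasurePreserving_snd.ae hreward)

theorem mean_mem_Icc (hν : ∀ k, ∀ᵐ y ∂(ν k), y ∈ Set.Icc (0 : ℝ) 1) (k : Fin K) :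
    mean ν k ∈ Set.Icc (0 : ℝ) 1 :=
  (convex_Icc 0 1).integral_mem isClosed_Icc (hν k)
    (Integrable.of_mem_Icc 0 1 aemeasurable_id (hν k))

variable [NeZero K] (hν : ∀ k, ∀ᵐ y ∂(ν k), y ∈ Set.Icc (0 : ℝ) 1)

theorem measurable_gain_right (p : Fin K → ℝ) (k : Fin K) : Measurable (gain p k) :=
  (measurable_gain k).comp measurable_prodMk_left

include hν in
theorem integrable_gain (p : Fin K → ℝ) (k : Fin K) : Integrable (gain p k) (agentLaw ν) :=
  Integrable.of_mem_Icc 0 1 (measurable_gain_right p k).aemeasurable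
    ((ae_agentLaw hν).mono fun _ hy => gain_mem_Icc p k hy.2)

variable {p : Fin K → ℝ} (hp : p ∈ stdSimplex ℝ (Fin K))

include hp in
theorem integral_gain (k : Fin K) : ∫ y, gain p k y ∂(agentLaw ν) = p k * mean ν k := by
  have hgain : ∀ y, gain p k y = (if draw p y.1 = k then (1 : ℝ) else 0) * y.2 k := fun y => by
    rw [gain, ite_mul, one_mul, zero_mul]
  simp_rw [hgain]
  rw [integral_prod_mul (fun u => if draw p u = k then (1 : ℝ) else 0) fun x : Fin K → ℝ => x k,
    setIntegral_draw_eq hp, integral_eval, mean]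

include hν hp

theorem integral_reward :
    ∫ y, y.2 (draw p y.1) ∂(agentLaw ν) = bestMean ν - ∑ k, p k * subGap ν k := by
  simp_rw [← sum_gain]
  rw [integral_finsetSum _ fun k _ => integrable_gain hν p k]
  simp_rw [integral_gain hp, subGap, mul_sub]
  rw [Finset.sum_sub_distrib, ← Finset.sum_mul, hp.2, one_mul, sub_sub_cancel]

theorem integral_exp_gain_le (k : Fin K) {a : ℝ} (ha : |a| ≤ 1) :
    ∫ y, Real.exp (a * gain p k y) ∂(agentLaw ν) ≤
      Real.exp (a * (p k * mean ν k) + a ^ 2 * p k) := by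
  have hint := integrable_gain hν p k
  have hexp : ∀ g ∈ Set.Icc (0 : ℝ) 1, Real.exp (a * g) ≤ 1 + (a + a ^ 2) * g := by
    rintro g ⟨hg0, hg1⟩
    have hag : |a * g| ≤ 1 := by
      rw [abs_mul, abs_of_nonneg hg0]
      exact mul_le_one₀ ha hg0 hg1
    have hsq : (a * g) ^ 2 ≤ a ^ 2 * g := by
      rw [mul_pow]
      gcongr
      nlinarith
    linarith [(abs_le.mp (Real.abs_exp_sub_one_sub_id_le hag)).2]
  calc ∫ y, Real.exp (a * gain p k y) ∂(agentLaw ν)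
      ≤ ∫ y, (1 + (a + a ^ 2) * gain p k y) ∂(agentLaw ν) :=
        integral_mono_of_nonneg (ae_of_all _ fun y => (Real.exp_pos _).le)
          ((integrable_const _).add (hint.const_mul _))
          ((ae_agentLaw hν).mono fun y hy => hexp _ (gain_mem_Icc p k hy.2))
    _ = 1 + (a * (p k * mean ν k) + a ^ 2 * (p k * mean ν k)) := by
        rw [integral_add (integrable_const _) (hint.const_mul _), integral_const_mul,
          integral_gain hp]
        simp
        ring
    _ ≤ 1 + (a * (p k * mean ν k) + a ^ 2 * p k) := by
        gcongr
        exact mul_le_of_le_one_right (hp.1 k) (mean_mem_Icc hν k).2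
    _ ≤ Real.exp (a * (p k * mean ν k) + a ^ 2 * p k) := by
        rw [add_comm]
        exact Real.add_one_le_exp _

end AgentLaw

/-! ### Functions of independent rounds -/

section Freezing

variable {Ω β γ : Type*} {mΩ : MeasurableSpace Ω} [mβ : MeasurableSpace β] [MeasurableSpace γ]
  {Q : Measure Ω} {X : Ω → γ}

theorem indepFun_of_indep_comap {m : MeasurableSpace Ω} {Z : Ω → β}
    (h : Indep m (mβ.comap Z) Q) (hX : Measurable[m] X) : IndepFun X Z Q :=
  (IndepFun_iff_Indep X Z Q).mpr (indep_of_indep_of_le_left h hX.comap_le)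

variable [IsProbabilityMeasure Q]

theorem lintegral_comp_prodMk {Z : Ω → β} (hX : Measurable X) (hZ : Measurable Z)
    (h : IndepFun X Z Q) {F : γ × β → ENNReal} (hF : Measurable F) :
    ∫⁻ ω, F (X ω, Z ω) ∂Q = ∫⁻ ω, ∫⁻ z, F (X ω, z) ∂(Q.map Z) ∂Q := by
  rw [← lintegral_map (f := F) hF (hX.prodMk hZ),
    h.map_prod_eq_prod_map_map hX.aemeasurable hZ.aemeasurable, lintegral_prod _ hF.aemeasurable,
    lintegral_map hF.lintegral_prod_right' hX]

theorem integral_comp_prodMk {Z : Ω → β} (hX : Measurable X) (hZ : Measurable Z)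
    (h : IndepFun X Z Q) {F : γ × β → ℝ} (hF : Measurable F)
    (hint : Integrable (fun ω => F (X ω, Z ω)) Q) :
    ∫ ω, F (X ω, Z ω) ∂Q = ∫ ω, ∫ z, F (X ω, z) ∂(Q.map Z) ∂Q := by
  have hmap := h.map_prod_eq_prod_map_map hX.aemeasurable hZ.aemeasurable
  have hint' : Integrable F ((Q.map X).prod (Q.map Z)) := by
    rw [← hmap]
    exact (integrable_map_measure hF.aestronglyMeasurable (hX.prodMk hZ).aemeasurable).mpr hint
  rw [← integral_map (f := F) (hX.prodMk hZ).aemeasurable hF.aestronglyMeasurable, hmap,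
    integral_prod _ hint', integral_map hX.aemeasurable
      hF.stronglyMeasurable.integral_prod_right'.aestronglyMeasurable]

theorem lintegral_prod_le_one (ℱ : Filtration ℕ mΩ) {Z : ℕ → Ω → β}
    (hZ : ∀ t, Measurable[ℱ (t + 1)] (Z t)) (hind : ∀ t, Indep (ℱ t) (mβ.comap (Z t)) Q)
    {π : Measure β} (hlaw : ∀ t, Q.map (Z t) = π) {s : ℕ} (hX : Measurable[ℱ s] X)
    {H : γ × β → ENNReal} (hH : Measurable H) (hH_le : ∀ x, ∫⁻ z, H (x, z) ∂π ≤ 1) (n : ℕ) :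
    ∫⁻ ω, ∏ t ∈ Finset.Ico s (s + n), H (X ω, Z t ω) ∂Q ≤ 1 := by
  induction n with
  | zero => simp
  | succ n ih =>
    have hXn : Measurable[ℱ (s + n)] X := hX.mono (ℱ.mono (by omega)) le_rfl
    have hpast : Measurable[ℱ (s + n)] fun ω => ∏ t ∈ Finset.Ico s (s + n), H (X ω, Z t ω) :=
      Finset.measurable_prod _ fun t ht => hH.comp <| hXn.prodMk <|
        (hZ t).mono (ℱ.mono (Finset.mem_Ico.mp ht).2) le_rfl
    have hpair := hXn.prodMk hpast
    have hF : Measurable fun q : (γ × ENNReal) × β => q.1.2 * H (q.1.1, q.2) := by fun_prop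
    calc ∫⁻ ω, ∏ t ∈ Finset.Ico s (s + (n + 1)), H (X ω, Z t ω) ∂Q
        = ∫⁻ ω, (∏ t ∈ Finset.Ico s (s + n), H (X ω, Z t ω)) * H (X ω, Z (s + n) ω) ∂Q := by
          simp_rw [← add_assoc, Finset.prod_Ico_succ_top (Nat.le_add_right s n)]
      _ = ∫⁻ ω, ∫⁻ z, (∏ t ∈ Finset.Ico s (s + n), H (X ω, Z t ω)) * H (X ω, z) ∂π ∂Q := by
          rw [← hlaw (s + n)]
          exact lintegral_comp_prodMk (hpair.mono (ℱ.le _) le_rfl) ((hZ _).mono (ℱ.le _) le_rfl)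
            (indepFun_of_indep_comap (hind _) hpair) hF
      _ ≤ ∫⁻ ω, ∏ t ∈ Finset.Ico s (s + n), H (X ω, Z t ω) ∂Q := by
          refine lintegral_mono fun ω => ?_
          rw [lintegral_const_mul _ (by fun_prop)]
          exact mul_le_of_le_one_right' (hH_le (X ω))
      _ ≤ 1 := ih

theorem measure_le_prod_le (ℱ : Filtration ℕ mΩ) {Z : ℕ → Ω → β}
    (hZ : ∀ t, Measurable[ℱ (t + 1)] (Z t)) (hind : ∀ t, Indep (ℱ t) (mβ.comap (Z t)) Q)
    {π : Measure β} (hlaw : ∀ t, Q.map (Z t) = π) {s : ℕ} (hX : Measurable[ℱ s] X)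
    {H : γ × β → ENNReal} (hH : Measurable H) (hH_le : ∀ x, ∫⁻ z, H (x, z) ∂π ≤ 1) (n : ℕ)
    {ε : ENNReal} (hε : ε ≠ 0) (hε' : ε ≠ ⊤) :
    Q {ω | ε ≤ ∏ t ∈ Finset.Ico s (s + n), H (X ω, Z t ω)} ≤ ε⁻¹ := by
  have hmeas : Measurable fun ω => ∏ t ∈ Finset.Ico s (s + n), H (X ω, Z t ω) :=
    Finset.measurable_prod _ fun t _ =>
      hH.comp ((hX.mono (ℱ.le s) le_rfl).prodMk ((hZ t).mono (ℱ.le _) le_rfl))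
  refine (meas_ge_le_lintegral_div hmeas.aemeasurable hε hε').trans ?_
  rw [← one_div]
  exact ENNReal.div_le_div_right (lintegral_prod_le_one ℱ hZ hind hlaw hX hH hH_le n) ε

end Freezing

/-! ### Concentration of the pooled means -/

/-- The seeds and reward vectors of all agents in one round. -/
abbrev Round (V K : ℕ) := Fin V → ℝ × (Fin K → ℝ)

section OneRound

variable {V K : ℕ} [NeZero K] {ν : Fin K → Measure ℝ} [∀ k, IsProbabilityMeasure (ν k)]
  (hν : ∀ k, ∀ᵐ y ∂(ν k), y ∈ Set.Icc (0 : ℝ) 1)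

include hν

theorem integrable_exp_gain {a : ℝ} (ha : |a| ≤ 1) (p : Fin K → ℝ) (k : Fin K) :
    Integrable (fun y => Real.exp (a * gain p k y)) (agentLaw ν) := by
  refine Integrable.of_mem_Icc 0 (Real.exp 1)
    ((measurable_gain_right p k).const_mul a).exp.aemeasurable ((ae_agentLaw hν).mono ?_)
  rintro y ⟨-, hy⟩
  have hgain := gain_mem_Icc p k hy
  exact ⟨(Real.exp_pos _).le, Real.exp_le_exp.mpr <|
    (mul_le_mul_of_nonneg_right ((le_abs_self a).trans ha) hgain.1).trans (by linarith [hgain.2])⟩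

theorem lintegral_exp_sum_gain_le_one {p : Fin V → Fin K → ℝ}
    (hp : ∀ j, p j ∈ stdSimplex ℝ (Fin K)) (k : Fin K) {a : Fin V → ℝ} (ha : ∀ j, |a j| ≤ 1) :
    ∫⁻ z : Round V K, ENNReal.ofReal (Real.exp (∑ j, (a j * gain (p j) k (z j) -
      (a j * (p j k * mean ν k) + a j ^ 2 * p j k)))) ∂(Measure.pi fun _ => agentLaw ν) ≤ 1 := by
  set c : Fin V → ℝ := fun j => a j * (p j k * mean ν k) + a j ^ 2 * p j k
  have hagent : ∀ j, ∫ y, Real.exp (a j * gain (p j) k y) / Real.exp (c j) ∂(agentLaw ν) ≤ 1 :=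
    fun j => by
      rw [integral_div, div_le_one (Real.exp_pos _)]
      exact integral_exp_gain_le hν (hp j) k (ha j)
  simp_rw [Real.exp_sum, Real.exp_sub]
  rw [← ofReal_integral_eq_lintegral_ofReal
      (Integrable.fintype_prod fun j => (integrable_exp_gain hν (ha j) (p j) k).div_const _)
      (ae_of_all _ fun z => by positivity),
    integral_fintype_prod_eq_prod fun j y => Real.exp (a j * gain (p j) k y) / Real.exp (c j)]
  exact ENNReal.ofReal_le_one.mpr <| Finset.prod_le_one
    (fun j _ => integral_nonneg fun y => by positivity) fun j _ => hagent j

end OneRound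

namespace Setup

variable {V K : ℕ} {P : Setup V K}

theorem Admissible.threshold_mul_sq (hP : P.Admissible) (i : Fin V) {δ : ℝ} (hδ : 0 < δ) :
    (1 - 2 * P.α) * (nbhd P.G 1 i).card * (P.threshold i δ * δ ^ 2) = P.lam := by
  rw [threshold, div_mul_eq_mul_div, mul_div_cancel₀ _ (hP.one_sub_mul_card_pos i).ne', mul_assoc,
    inv_mul_cancel₀ (by positivity), mul_one]

theorem Admissible.threshold_nonneg (hP : P.Admissible) (i : Fin V) (δ : ℝ) :
    0 ≤ P.threshold i δ := by
  have := P.lam_nonneg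
  have := hP.one_sub_mul_card_pos i
  unfold threshold
  positivity

theorem Admissible.threshold_pos (hP : P.Admissible) (hT : 1 ≤ P.T) (i : Fin V) {δ : ℝ}
    (hδ : 0 < δ) : 0 < P.threshold i δ := by
  have := hP.le_lam hT
  have := hP.one_sub_mul_card_pos i
  unfold threshold
  positivity

theorem measurable_threshold (P : Setup V K) (i : Fin V) : Measurable (P.threshold i) := by
  unfold threshold
  fun_prop

variable [NeZero K]

theorem Admissible.pullProb_mem_stdSimplex (hP : P.Admissible) (hT : 1 ≤ P.T) (m : ℕ) (i : Fin V)
    (Δ : Fin K → ℝ) : P.pullProb m i Δ ∈ stdSimplex ℝ (Fin K) := by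
  have hlen : (P.len m : ℝ) ≠ 0 := by exact_mod_cast (hP.len_pos hT m).ne'
  refine ⟨fun k => div_nonneg (hP.alloc_nonneg m i Δ k) (Nat.cast_nonneg _), ?_⟩
  simp_rw [pullProb]
  rw [← Finset.sum_div, P.sum_alloc, div_self hlen]

variable {ν : Fin K → Measure ℝ}

/-- The factor that the round `q.2` of epoch `m` contributes to the exponential supermartingale for
arm `k`, when the gap estimates are `q.1` and the rewards of agent `j` are tilted by `a q.1 j`. -/
noncomputable def tiltFactor (P : Setup V K) (ν : Fin K → Measure ℝ) (m : ℕ) (k : Fin K)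
    (a : (Fin V → Fin K → ℝ) → Fin V → ℝ) (q : (Fin V → Fin K → ℝ) × Round V K) : ENNReal :=
  ENNReal.ofReal (Real.exp (∑ j, (a q.1 j * gain (P.pullProb m j (q.1 j)) k (q.2 j) -
    (a q.1 j * (P.pullProb m j (q.1 j) k * mean ν k) + a q.1 j ^ 2 * P.pullProb m j (q.1 j) k))))

theorem measurable_tiltFactor (m : ℕ) (k : Fin K) {a : (Fin V → Fin K → ℝ) → Fin V → ℝ}
    (ha : Measurable a) : Measurable (P.tiltFactor ν m k a) := by
  have hp : ∀ j, Measurable fun q : (Fin V → Fin K → ℝ) × Round V K => P.pullProb m j (q.1 j) :=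
    fun j => (P.measurable_pullProb m j).comp (by fun_prop)
  have hpk : ∀ j, Measurable fun q : (Fin V → Fin K → ℝ) × Round V K =>
      P.pullProb m j (q.1 j) k := fun j => (measurable_pi_apply k).comp (hp j)
  have hgain : ∀ j, Measurable fun q : (Fin V → Fin K → ℝ) × Round V K =>
      gain (P.pullProb m j (q.1 j)) k (q.2 j) := fun j =>
    ((measurable_gain k).comp ((hp j).prodMk ((measurable_pi_apply j).comp measurable_snd)) :)
  have hweight : ∀ j, Measurable fun q : (Fin V → Fin K → ℝ) × Round V K => a q.1 j := by fun_prop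
  exact (Finset.measurable_sum _ fun j _ => ((hweight j).mul (hgain j)).sub
    (((hweight j).mul ((hpk j).mul_const _)).add
      (((hweight j).pow_const 2).mul (hpk j)))).exp.ennreal_ofReal

variable {Ω : Type*} {mΩ : MeasurableSpace Ω} {Q : Measure Ω}

namespace Environment

/-- The seeds and reward vectors of all agents in round `t`. -/
def round (E : P.Environment ν Q) (t : ℕ) (ω : Ω) : Round V K :=
  fun i => ((E.path ω).u t i, (E.path ω).x t i)

omit [NeZero K] in
theorem measurable_round (E : P.Environment ν Q) (t : ℕ) : Measurable[E.ℱ (t + 1)] (E.round t) :=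
  @measurable_pi_lambda _ _ _ (E.ℱ (t + 1)) _ _ fun i =>
    (E.measurable_u t i).prodMk (E.measurable_x t i)

theorem prod_tiltFactor (E : P.Environment ν Q) {m : ℕ} (hm : P.len m ≠ 0) (k : Fin K)
    (a : (Fin V → Fin K → ℝ) → Fin V → ℝ) (ω : Ω) :
    ∏ t ∈ Finset.Ico (P.start m) (P.start m + P.len m),
      P.tiltFactor ν m k a (P.gap (E.path ω) m, E.round t ω) = ENNReal.ofReal (Real.exp
        (∑ j, (a (P.gap (E.path ω) m) j * (P.rewardSum m j (P.gap (E.path ω) m j) (E.path ω) k -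
          P.pulls (E.path ω) m j k * mean ν k) -
            a (P.gap (E.path ω) m) j ^ 2 * P.pulls (E.path ω) m j k))) := by
  have hlen : (P.len m : ℝ) ≠ 0 := Nat.cast_ne_zero.mpr hm
  simp only [tiltFactor]
  rw [← ENNReal.ofReal_prod_of_nonneg fun t _ => (Real.exp_pos _).le, ← Real.exp_sum,
    Finset.sum_comm]
  congr 3 with j
  rw [Finset.sum_sub_distrib, ← Finset.mul_sum, Finset.sum_const, Nat.card_Ico,
    Nat.add_sub_cancel_left, nsmul_eq_mul, rewardSum_eq_sum_gain]
  simp only [pulls, pullProb, round]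
  field_simp
  ring

theorem measure_le_sum_rewardSum_le [IsProbabilityMeasure Q] [∀ k, IsProbabilityMeasure (ν k)]
    (E : P.Environment ν Q) (hP : P.Admissible) (hT : 1 ≤ P.T)
    (hν : ∀ k, ∀ᵐ y ∂(ν k), y ∈ Set.Icc (0 : ℝ) 1) (m : ℕ) (k : Fin K)
    {a : (Fin V → Fin K → ℝ) → Fin V → ℝ} (ha : Measurable a) (ha_le : ∀ Δ j, |a Δ j| ≤ 1)
    (x : ℝ) :
    Q {ω | x ≤ ∑ j, (a (P.gap (E.path ω) m) j *
      (P.rewardSum m j (P.gap (E.path ω) m j) (E.path ω) k - P.pulls (E.path ω) m j k * mean ν k) -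
        a (P.gap (E.path ω) m) j ^ 2 * P.pulls (E.path ω) m j k)} ≤
      ENNReal.ofReal (Real.exp (-x)) := by
  have hfactor : ∀ Δ, ∫⁻ z, P.tiltFactor ν m k a (Δ, z) ∂(Measure.pi fun _ => agentLaw ν) ≤ 1 :=
    fun Δ => lintegral_exp_sum_gain_le_one hν
      (fun j => hP.pullProb_mem_stdSimplex hT m j (Δ j)) k (ha_le Δ)
  have hmarkov := measure_le_prod_le E.ℱ E.measurable_round E.indep E.law (E.measurable_gap m)
    (measurable_tiltFactor m k ha) hfactor (P.len m)
    (ENNReal.ofReal_pos.mpr (Real.exp_pos x)).ne' ENNReal.ofReal_ne_top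
  simp_rw [E.prod_tiltFactor (hP.len_pos hT m).ne',
    ENNReal.ofReal_le_ofReal_iff (Real.exp_pos _).le, Real.exp_le_exp] at hmarkov
  rwa [Real.exp_neg, ENNReal.ofReal_inv_of_pos (Real.exp_pos x)]

end Environment

variable {V K : ℕ} {P : Setup V K}

section Tilt

variable {m : ℕ} {i : Fin V} {k : Fin K} {W : Finset (Fin V)} {s : ℝ}

/-- The tilt of the rewards that agent `j` obtains from arm `k` in epoch `m`, given the gap
estimates `Δ`. Up to the sign `s` it is `θ / ñ`, where `θ = n * δ / 16` maximizes
`θ * (δ / 8) - θ ^ 2 / n` for `δ = Δ i k` and `n = P.threshold i δ`. -/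
noncomputable def tilt (P : Setup V K) (m : ℕ) (i : Fin V) (k : Fin K) (W : Finset (Fin V)) (s : ℝ)
    (Δ : Fin V → Fin K → ℝ) (j : Fin V) : ℝ :=
  open Classical in
  if j ∈ W ∧ P.threshold i (Δ i k) ≤ P.alloc m j (Δ j) k ∧ |Δ i k| ≤ 4
  then s * (P.threshold i (Δ i k) * Δ i k / 16) / P.alloc m j (Δ j) k
  else 0

theorem measurable_tilt (P : Setup V K) (m : ℕ) (i : Fin V) (k : Fin K) (W : Finset (Fin V))
    (s : ℝ) : Measurable (P.tilt m i k W s) := by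
  have hδ : Measurable fun Δ : Fin V → Fin K → ℝ => Δ i k := by fun_prop
  have hthr : Measurable fun Δ : Fin V → Fin K → ℝ => P.threshold i (Δ i k) :=
    (P.measurable_threshold i).comp hδ
  have halloc : ∀ j, Measurable fun Δ : Fin V → Fin K → ℝ => P.alloc m j (Δ j) k := fun j =>
    (measurable_pi_apply k).comp ((P.measurable_alloc m j).comp (measurable_pi_apply j))
  refine measurable_pi_lambda _ fun j => Measurable.ite ?_
    ((((hthr.mul hδ).div_const 16).const_mul s).div (halloc j)) measurable_const
  exact (MeasurableSet.const _).inter ((measurableSet_le hthr (halloc j)).inter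
    (measurableSet_le hδ.abs measurable_const))

theorem Admissible.abs_tilt_le_one (hP : P.Admissible) (hs : |s| = 1) (Δ : Fin V → Fin K → ℝ)
    (j : Fin V) : |P.tilt m i k W s Δ j| ≤ 1 := by
  rw [tilt]
  split_ifs with h
  · obtain ⟨-, hle, hΔ⟩ := h
    have hthr := hP.threshold_nonneg i (Δ i k)
    rw [abs_div, abs_mul, hs, one_mul, abs_div, abs_mul, abs_of_nonneg hthr,
      abs_of_nonneg (hthr.trans hle)]
    refine div_le_one_of_le₀ (le_trans ?_ hle) (hthr.trans hle)
    rw [abs_of_pos (by norm_num : (0 : ℝ) < 16)]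
    nlinarith
  · simp

variable [NeZero K] {ξ : Path V K} {c : ℝ}

theorem sum_tilt_eq (hpulls : ∀ j ∈ W, P.threshold i (P.gap ξ m i k) ≤ P.pulls ξ m j k)
    (hpos : ∀ j ∈ W, P.pulls ξ m j k ≠ 0) (hgap : P.gap ξ m i k ≤ 4) :
    ∑ j, (P.tilt m i k W s (P.gap ξ m) j *
        (P.rewardSum m j (P.gap ξ m j) ξ k - P.pulls ξ m j k * c) -
          P.tilt m i k W s (P.gap ξ m) j ^ 2 * P.pulls ξ m j k) =
      ∑ j ∈ W, (s * (P.threshold i (P.gap ξ m i k) * P.gap ξ m i k / 16) * (P.empMean ξ m j k - c) -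
        (s * (P.threshold i (P.gap ξ m i k) * P.gap ξ m i k / 16)) ^ 2 / P.pulls ξ m j k) := by
  classical
  have habs : |P.gap ξ m i k| ≤ 4 := by rwa [abs_of_pos (P.gap_pos ξ m i k)]
  rw [← Finset.sum_subset (Finset.subset_univ W)]
  · refine Finset.sum_congr rfl fun j hj => ?_
    have := hpos j hj
    rw [tilt, if_pos ⟨hj, hpulls j hj, habs⟩, empMean, ← pulls]
    field_simp
  · intro j _ hj
    rw [tilt, if_neg fun h => hj h.1]
    ring

theorem Admissible.lam_div_le_sum_tilt (hP : P.Admissible) (hT : 1 ≤ P.T) (hs : |s| = 1)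
    (hW : (1 - 2 * P.α) * (nbhd P.G 1 i).card ≤ W.card)
    (hpulls : ∀ j ∈ W, P.threshold i (P.gap ξ m i k) ≤ P.pulls ξ m j k)
    (hgap : P.gap ξ m i k ≤ 4)
    (hdev : P.gap ξ m i k / 8 < s * ((∑ j ∈ W, P.empMean ξ m j k) / W.card - c)) :
    P.lam / 256 ≤ ∑ j, (P.tilt m i k W s (P.gap ξ m) j *
        (P.rewardSum m j (P.gap ξ m j) ξ k - P.pulls ξ m j k * c) -
          P.tilt m i k W s (P.gap ξ m) j ^ 2 * P.pulls ξ m j k) := by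
  set g := P.gap ξ m i k
  set thr := P.threshold i g
  have hg : 0 < g := P.gap_pos ξ m i k
  have hWpos : (0 : ℝ) < W.card := (hP.one_sub_mul_card_pos i).trans_le hW
  have hlam : (1 - 2 * P.α) * (nbhd P.G 1 i).card * (thr * g ^ 2) = P.lam :=
    hP.threshold_mul_sq i hg
  have hthr : 0 < thr := hP.threshold_pos hT i hg
  have hvar : ∑ j ∈ W, (s * (thr * g / 16)) ^ 2 / P.pulls ξ m j k ≤
      W.card * (thr * g ^ 2 / 256) := by
    rw [← nsmul_eq_mul]
    refine Finset.sum_le_card_nsmul _ _ _ fun j hj => ?_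
    calc (s * (thr * g / 16)) ^ 2 / P.pulls ξ m j k
        ≤ (s * (thr * g / 16)) ^ 2 / thr := by
          gcongr
          exact hpulls j hj
      _ = thr * g ^ 2 / 256 := by
          rw [mul_pow, ← sq_abs s, hs]
          field_simp
          norm_num
  have hmean : W.card * (thr * g ^ 2 / 128) ≤
      ∑ j ∈ W, s * (thr * g / 16) * (P.empMean ξ m j k - c) := by
    rw [← Finset.mul_sum, Finset.sum_sub_distrib, Finset.sum_const, nsmul_eq_mul]
    calc W.card * (thr * g ^ 2 / 128) = W.card * (thr * g / 16) * (g / 8) := by ring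
      _ ≤ W.card * (thr * g / 16) * (s * ((∑ j ∈ W, P.empMean ξ m j k) / W.card - c)) := by gcongr
      _ = s * (thr * g / 16) * (∑ j ∈ W, P.empMean ξ m j k - W.card * c) := by field_simp
  have hcard := mul_le_mul_of_nonneg_right hW (by positivity : 0 ≤ thr * g ^ 2)
  rw [sum_tilt_eq hpulls (fun j hj => (hthr.trans_le (hpulls j hj)).ne') hgap,
    Finset.sum_sub_distrib]
  linarith

end Tilt

section Deviation

variable [NeZero K] {ν : Fin K → Measure ℝ} {Ω : Type*} {mΩ : MeasurableSpace Ω} {Q : Measure Ω}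
  [IsProbabilityMeasure Q] [∀ k, IsProbabilityMeasure (ν k)] (E : P.Environment ν Q)
  (hP : P.Admissible) (hT : 1 ≤ P.T) (hν : ∀ k, ∀ᵐ y ∂(ν k), y ∈ Set.Icc (0 : ℝ) 1)

include hP hT

omit [NeZero K] in
theorem Admissible.exp_neg_lam_div :
    Real.exp (-(P.lam / 256)) = ((2 * V * P.T : ℝ) ^ 2)⁻¹ := by
  have hpos : (0 : ℝ) < 2 * V * P.T := by linarith [hP.one_le_mul hT]
  rw [show P.lam / 256 = 2 * Real.log (2 * V * P.T) by rw [lam]; ring, Real.exp_neg, two_mul,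
    Real.exp_add, Real.exp_log hpos, sq]

omit [NeZero K] in
theorem Admissible.numEpochs_le : P.numEpochs ≤ V * P.T :=
  Nat.log_lt_self 2 (by exact_mod_cast (zero_lt_one.trans_le (hP.one_le_mul hT)).ne')

include hν

namespace Environment

variable {i : Fin V} {W : Finset (Fin V)} (hW : (1 - 2 * P.α) * (nbhd P.G 1 i).card ≤ W.card)
  (m : ℕ) (k : Fin K)

include hW

theorem measure_lt_mul_dev_le {s : ℝ} (hs : |s| = 1) :
    Q {ω | (∀ j ∈ W, P.threshold i (P.gap (E.path ω) m i k) ≤ P.pulls (E.path ω) m j k) ∧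
        P.gap (E.path ω) m i k ≤ 4 ∧ P.gap (E.path ω) m i k / 8 <
          s * ((∑ j ∈ W, P.empMean (E.path ω) m j k) / W.card - mean ν k)} ≤
      ENNReal.ofReal ((2 * V * P.T : ℝ) ^ 2)⁻¹ := by
  rw [← hP.exp_neg_lam_div hT]
  refine (measure_mono ?_).trans <| E.measure_le_sum_rewardSum_le hP hT hν m k
    (P.measurable_tilt m i k W s) (fun Δ j => hP.abs_tilt_le_one hs Δ j) (P.lam / 256)
  rintro ω ⟨hpulls, hgap, hdev⟩
  exact hP.lam_div_le_sum_tilt hT hs hW hpulls hgap hdev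

theorem measure_lt_abs_dev_le :
    Q {ω | (∀ j ∈ W, P.threshold i (P.gap (E.path ω) m i k) ≤ P.pulls (E.path ω) m j k) ∧
        P.gap (E.path ω) m i k ≤ 4 ∧ P.gap (E.path ω) m i k / 8 <
          |(∑ j ∈ W, P.empMean (E.path ω) m j k) / W.card - mean ν k|} ≤
      2 * ENNReal.ofReal ((2 * V * P.T : ℝ) ^ 2)⁻¹ := by
  rw [two_mul]
  refine (measure_mono ?_).trans <| (measure_union_le _ _).trans <| add_le_add
    (E.measure_lt_mul_dev_le hP hT hν hW m k (abs_one))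
    (E.measure_lt_mul_dev_le hP hT hν hW m k (s := -1) (by simp))
  rintro ω ⟨hpulls, hgap, hdev⟩
  exact (lt_abs.mp hdev).imp (fun h => ⟨hpulls, hgap, by rwa [one_mul]⟩)
    fun h => ⟨hpulls, hgap, by rwa [neg_one_mul]⟩

end Environment

theorem Environment.measure_not_accurate_le :
    Q {ω | ∃ m < P.numEpochs, ¬ P.Accurate ν (E.path ω) m} ≤ ENNReal.ofReal (K * 2 ^ V / P.T) := by
  classical
  set ε := ENNReal.ofReal ((2 * V * P.T : ℝ) ^ 2)⁻¹
  let B (x : ℕ × Fin V × Fin K × Finset (Fin V)) : Set Ω :=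
    {ω | (1 - 2 * P.α) * (nbhd P.G 1 x.2.1).card ≤ x.2.2.2.card ∧
      (∀ j ∈ x.2.2.2, P.threshold x.2.1 (P.gap (E.path ω) x.1 x.2.1 x.2.2.1) ≤
        P.pulls (E.path ω) x.1 j x.2.2.1) ∧
      P.gap (E.path ω) x.1 x.2.1 x.2.2.1 ≤ 4 ∧ P.gap (E.path ω) x.1 x.2.1 x.2.2.1 / 8 <
        |(∑ j ∈ x.2.2.2, P.empMean (E.path ω) x.1 j x.2.2.1) / x.2.2.2.card - mean ν x.2.2.1|}
  have hB : ∀ x, Q (B x) ≤ 2 * ε := fun ⟨m, i, k, W⟩ => by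
    by_cases hW : (1 - 2 * P.α) * (nbhd P.G 1 i).card ≤ W.card
    · exact (measure_mono fun ω hω => hω.2).trans (E.measure_lt_abs_dev_le hP hT hν hW m k)
    · simp [B, hW]
  have hsub : {ω | ∃ m < P.numEpochs, ¬ P.Accurate ν (E.path ω) m} ⊆
      ⋃ x ∈ Finset.range P.numEpochs ×ˢ Finset.univ, B x := by
    rintro ω ⟨m, hm, hω⟩
    simp only [Accurate, not_forall, not_le] at hω
    obtain ⟨i, k, W, hpulls, hW, hgap, hdev⟩ := hω
    exact Set.mem_biUnion (x := (m, i, k, W)) (by simpa using hm) ⟨hW, hpulls, hgap, hdev⟩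
  have hcard : (Finset.range P.numEpochs ×ˢ
      (Finset.univ : Finset (Fin V × Fin K × Finset (Fin V)))).card ≤
        V * P.T * (V * (K * 2 ^ V)) := by
    simpa [Finset.card_product] using Nat.mul_le_mul_right (V * (K * 2 ^ V)) (hP.numEpochs_le hT)
  have hVT : (0 : ℝ) < V * P.T := zero_lt_one.trans_le (hP.one_le_mul hT)
  obtain ⟨hV, hT'⟩ := mul_ne_zero_iff.mp hVT.ne'
  calc Q {ω | ∃ m < P.numEpochs, ¬ P.Accurate ν (E.path ω) m}
      ≤ ∑ x ∈ Finset.range P.numEpochs ×ˢ Finset.univ, Q (B x) :=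
        (measure_mono hsub).trans (measure_biUnion_finset_le _ _)
    _ ≤ (V * P.T * (V * (K * 2 ^ V)) : ℕ) * (2 * ε) := by
        refine (Finset.sum_le_card_nsmul _ _ _ fun x _ => hB x).trans ?_
        rw [nsmul_eq_mul]
        gcongr
    _ = ENNReal.ofReal (K * 2 ^ V / P.T / 2) := by
        rw [← ENNReal.ofReal_natCast, ← ENNReal.ofReal_ofNat, ← ENNReal.ofReal_mul (by simp),
          ← ENNReal.ofReal_mul (by positivity)]
        congr 1
        push_cast
        field_simp
    _ ≤ ENNReal.ofReal (K * 2 ^ V / P.T) :=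
        ENNReal.ofReal_le_ofReal (half_le_self (by positivity))

end Deviation

end Setup

/-! ### Regret of a round and of an epoch -/

theorem measurable_drawn {K : ℕ} [NeZero K] :
    Measurable fun q : (Fin K → ℝ) × (ℝ × (Fin K → ℝ)) => q.2.2 (draw q.1 q.2.1) := by
  simp_rw [← sum_gain]
  exact Finset.measurable_sum _ fun k _ => measurable_gain k

namespace Setup

variable {V K : ℕ} {P : Setup V K} [NeZero K]

section Round

variable {ξ : Path V K} {t : ℕ} {i : Fin V} {ν : Fin K → Measure ℝ}

/-- The distribution of the arm that agent `i`, with gap estimates `Δ`, pulls in round `t`; the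
arm is deterministic in a communication round. -/
noncomputable def armProb (P : Setup V K) (t : ℕ) (i : Fin V) (Δ : Fin K → ℝ) : Fin K → ℝ :=
  open Classical in
  if P.IsComm t then Pi.single (P.lead (P.epoch t) i Δ) 1 else P.pullProb (P.epoch t) i Δ

/-- The expected regret of agent `i` in round `t`, given the past. -/
noncomputable def roundRegret (P : Setup V K) (ν : Fin K → Measure ℝ) (ξ : Path V K) (t : ℕ)
    (i : Fin V) : ℝ :=
  ∑ k, P.armProb t i (P.gap ξ (P.epoch t) i) k * subGap ν k

/-- The expected regret of agent `i` in all of epoch `m`, given the past. -/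
noncomputable def epochRegret (P : Setup V K) (ν : Fin K → Measure ℝ) (ξ : Path V K) (m : ℕ)
    (i : Fin V) : ℝ :=
  ∑ k, P.pulls ξ m i k * subGap ν k + subGap ν (P.lead m i (P.gap ξ m i))

theorem arm_eq_draw (hi : i ∉ P.byz) (hu : ξ.u t i ∈ Set.Ico (0 : ℝ) 1) :
    P.arm ξ t i = draw (P.armProb t i (P.gap ξ (P.epoch t) i)) (ξ.u t i) := by
  rw [arm, armProb, if_neg hi]
  split_ifs
  exacts [(draw_single hu _).symm, rfl]

omit [NeZero K] in
theorem measurable_armProb : Measurable (P.armProb t i) := by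
  by_cases ht : P.IsComm t
  · rw [show P.armProb t i = (fun k => Pi.single k 1) ∘ P.lead (P.epoch t) i from
      funext fun _ => if_pos ht]
    exact (measurable_of_countable _).comp (P.measurable_lead (P.epoch t) i)
  · rw [show P.armProb t i = P.pullProb (P.epoch t) i from funext fun _ => if_neg ht]
    exact P.measurable_pullProb (P.epoch t) i

theorem sum_roundRegret_epoch {m : ℕ} (hm : P.len m ≠ 0) :
    ∑ t ∈ Finset.Ico (P.start m) (P.start m + P.len m), P.roundRegret ν ξ t i +
      P.roundRegret ν ξ (P.start m + P.len m) i = P.epochRegret ν ξ m i := by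
  have hlen : (P.len m : ℝ) ≠ 0 := Nat.cast_ne_zero.mpr hm
  congr 1
  · have hround : ∀ t ∈ Finset.Ico (P.start m) (P.start m + P.len m), P.roundRegret ν ξ t i =
        ∑ k, P.pulls ξ m i k / P.len m * subGap ν k := fun t ht => by
      simp only [roundRegret, armProb, if_neg (not_isComm_of_mem_Ico ht), epoch_eq_of_mem_Ico ht,
        pullProb, pulls]
    rw [Finset.sum_congr rfl hround, Finset.sum_const, Nat.card_Ico, Nat.add_sub_cancel_left,
      nsmul_eq_mul, Finset.mul_sum]
    refine Finset.sum_congr rfl fun k _ => ?_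
    field_simp
  · simp [roundRegret, armProb, P.isComm_start_add_len, P.epoch_start_add_len, Pi.single_apply]

namespace Admissible

variable (hP : P.Admissible) (hT : 1 ≤ P.T)

include hP hT

theorem armProb_mem_stdSimplex (t : ℕ) (i : Fin V) (Δ : Fin K → ℝ) :
    P.armProb t i Δ ∈ stdSimplex ℝ (Fin K) := by
  rw [armProb]
  split_ifs
  exacts [single_mem_stdSimplex ℝ _, hP.pullProb_mem_stdSimplex hT _ i Δ]

theorem roundRegret_nonneg : 0 ≤ P.roundRegret ν ξ t i :=
  Finset.sum_nonneg fun k _ =>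
    mul_nonneg ((hP.armProb_mem_stdSimplex hT t i _).1 k) (subGap_nonneg ν k)

theorem roundRegret_le_one (hmean : ∀ k, mean ν k ∈ Set.Icc (0 : ℝ) 1) :
    P.roundRegret ν ξ t i ≤ 1 := by
  obtain ⟨hnonneg, hsum⟩ := hP.armProb_mem_stdSimplex hT t i (P.gap ξ (P.epoch t) i)
  rw [← hsum]
  exact Finset.sum_le_sum fun k _ =>
    mul_le_of_le_one_right (hnonneg k) (subGap_le_one hmean k)

theorem sum_roundRegret_le :
    ∑ t ∈ Finset.range P.T, P.roundRegret ν ξ t i ≤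
      ∑ m ∈ Finset.range P.numEpochs, P.epochRegret ν ξ m i := by
  simp_rw [← sum_roundRegret_epoch (hP.len_pos hT _).ne']
  rw [← P.sum_range_start]
  exact Finset.sum_le_sum_of_subset_of_nonneg
    (Finset.range_subset_range.mpr (hP.horizon_le_start hT))
    fun t _ _ => hP.roundRegret_nonneg hT

end Admissible

end Round

/-! ### The regret as an expected sum of conditional regrets -/

namespace Environment

variable {ν : Fin K → Measure ℝ} [∀ k, IsProbabilityMeasure (ν k)] {Ω : Type*}
  {mΩ : MeasurableSpace Ω} {Q : Measure Ω} (E : P.Environment ν Q) (t : ℕ) (i : Fin V)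

omit [NeZero K] in
theorem measurePreserving_round : MeasurePreserving (fun ω => E.round t ω i) Q (agentLaw ν) :=
  (measurePreserving_eval (fun _ : Fin V => agentLaw ν) i).comp
    ⟨(E.measurable_round t).mono (E.ℱ.le _) le_rfl, E.law t⟩

omit [∀ k, IsProbabilityMeasure (ν k)] in
theorem measurable_armProb_gap : Measurable[E.ℱ t]
    fun ω => P.armProb t i (P.gap (E.path ω) (P.epoch t) i) :=
  measurable_armProb.comp <| (measurable_pi_apply i).comp <|
    (E.measurable_gap (P.epoch t)).mono (E.ℱ.mono (P.start_epoch_le t)) le_rfl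

omit [∀ k, IsProbabilityMeasure (ν k)] in
theorem indepFun_armProb_gap_round :
    IndepFun (fun ω => P.armProb t i (P.gap (E.path ω) (P.epoch t) i))
      (fun ω => E.round t ω i) Q :=
  (indepFun_of_indep_comap (E.indep t) (E.measurable_armProb_gap t i)).comp
    measurable_id (measurable_pi_apply i)

omit [∀ k, IsProbabilityMeasure (ν k)] in
theorem measurable_drawn_reward : Measurable fun ω => (E.round t ω i).2
    (draw (P.armProb t i (P.gap (E.path ω) (P.epoch t) i)) (E.round t ω i).1) := by
  exact (measurable_drawn.comp
    (((E.measurable_armProb_gap t i).mono (E.ℱ.le _) le_rfl).prodMk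
      ((measurable_pi_apply i).comp ((E.measurable_round t).mono (E.ℱ.le _) le_rfl))) :)

omit [∀ k, IsProbabilityMeasure (ν k)] in
theorem measurable_roundRegret :
    Measurable fun ω => P.roundRegret ν (E.path ω) t i :=
  Finset.measurable_sum _ fun k _ => ((measurable_pi_apply k).comp
    ((E.measurable_armProb_gap t i).mono (E.ℱ.le _) le_rfl)).mul_const _

variable (hν : ∀ k, ∀ᵐ y ∂(ν k), y ∈ Set.Icc (0 : ℝ) 1) [IsProbabilityMeasure Q]
  (hP : P.Admissible) (hT : 1 ≤ P.T)

include hν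

theorem integrable_drawn_reward : Integrable (fun ω => (E.round t ω i).2
    (draw (P.armProb t i (P.gap (E.path ω) (P.epoch t) i)) (E.round t ω i).1)) Q :=
  Integrable.of_mem_Icc 0 1 (E.measurable_drawn_reward t i).aemeasurable <|
    ((E.measurePreserving_round t i).quasiMeasurePreserving.ae (ae_agentLaw hν)).mono
      fun _ hω => hω.2 _

include hP hT

theorem integrable_roundRegret : Integrable (fun ω => P.roundRegret ν (E.path ω) t i) Q :=
  Integrable.of_mem_Icc 0 1 (E.measurable_roundRegret t i).aemeasurable <|
    ae_of_all _ fun _ => ⟨hP.roundRegret_nonneg hT, hP.roundRegret_le_one hT (mean_mem_Icc hν)⟩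

theorem integral_drawn_reward :
    ∫ ω, (E.round t ω i).2
      (draw (P.armProb t i (P.gap (E.path ω) (P.epoch t) i)) (E.round t ω i).1) ∂Q =
        bestMean ν - ∫ ω, P.roundRegret ν (E.path ω) t i ∂Q := by
  rw [integral_comp_prodMk ((E.measurable_armProb_gap t i).mono (E.ℱ.le _) le_rfl)
    (E.measurePreserving_round t i).measurable (E.indepFun_armProb_gap_round t i) measurable_drawn
    (E.integrable_drawn_reward t i hν), (E.measurePreserving_round t i).map_eq]
  simp_rw [integral_reward hν (hP.armProb_mem_stdSimplex hT t i _)]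
  change ∫ ω, (bestMean ν - P.roundRegret ν (E.path ω) t i) ∂Q = _
  rw [integral_sub (integrable_const _) (E.integrable_roundRegret t i hν hP hT)]
  simp

theorem regret_eq {i : Fin V} (hi : i ∉ P.byz) :
    regret P ν E i = ∫ ω, ∑ t ∈ Finset.range P.T, P.roundRegret ν (E.path ω) t i ∂Q := by
  have hdraw : ∀ t, (fun ω => (E.path ω).x t i (P.arm (E.path ω) t i)) =ᵐ[Q] fun ω =>
      (E.round t ω i).2
        (draw (P.armProb t i (P.gap (E.path ω) (P.epoch t) i)) (E.round t ω i).1) := fun t => by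
    filter_upwards [(E.measurePreserving_round t i).quasiMeasurePreserving.ae (ae_agentLaw hν)]
      with ω hω
    rw [arm_eq_draw hi hω.1]
    rfl
  rw [regret, integral_finsetSum _ fun t _ =>
      (E.integrable_drawn_reward t i hν).congr (hdraw t).symm,
    integral_finsetSum _ fun t _ => E.integrable_roundRegret t i hν hP hT]
  simp_rw [integral_congr_ae (hdraw _), E.integral_drawn_reward _ i hν hP hT]
  simp

end Environment

end Setup

/-! ### Regret on accurate runs -/

section MinGap

variable {K : ℕ} {ν : Fin K → Measure ℝ} {k : Fin K}

theorem minGap_le (hk : 0 < subGap ν k) : minGap ν ≤ subGap ν k :=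
  ciInf_le (Set.finite_range _).bddBelow (⟨k, hk⟩ : {k : Fin K // 0 < subGap ν k})

theorem minGap_pos (hk : 0 < subGap ν k) : 0 < minGap ν := by
  have : Nonempty {k : Fin K // 0 < subGap ν k} := ⟨⟨k, hk⟩⟩
  obtain ⟨l, hl⟩ := exists_eq_ciInf_of_finite
    (f := fun k : {k : Fin K // 0 < subGap ν k} => subGap ν k.1)
  rw [minGap, ← hl]
  exact l.2

theorem minGap_nonneg (ν : Fin K → Measure ℝ) : 0 ≤ minGap ν :=
  Real.iInf_nonneg fun k => k.2.le

theorem one_le_sum_inv_subGap [NeZero K] (hν : ∀ k, mean ν k ∈ Set.Icc (0 : ℝ) 1)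
    (hk : 0 < subGap ν k) : 1 ≤ ∑ k with 0 < subGap ν k, (subGap ν k)⁻¹ :=
  ((one_le_inv₀ hk).mpr (subGap_le_one hν k)).trans <|
    Finset.single_le_sum (f := fun k => (subGap ν k)⁻¹)
      (fun l _ => inv_nonneg.mpr (subGap_nonneg ν l)) (by simpa using hk)

end MinGap

theorem one_div_le_one_add_log_div {x : ℝ} (hx : 0 < x) : 1 / x ≤ 1 + Real.log (1 / x) / x := by
  have hlog := Real.one_sub_inv_le_log_of_pos (one_div_pos.mpr hx)
  rw [inv_div, div_one] at hlog
  rwa [← sub_le_iff_le_add', le_div_iff₀ hx, sub_mul, one_div_mul_cancel hx.ne', one_mul]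

theorem sum_two_pow_of_le {x : ℝ} (hx : 0 ≤ x) (n : ℕ) :
    ∑ m ∈ Finset.range n, (if 2 ^ m ≤ x then (2 : ℝ) ^ m else 0) ≤ 2 * x := by
  induction n with
  | zero => simpa using hx
  | succ n ih =>
    by_cases hn : 2 ^ n ≤ x
    · calc ∑ m ∈ Finset.range (n + 1), (if 2 ^ m ≤ x then (2 : ℝ) ^ m else 0)
          ≤ ∑ m ∈ Finset.range (n + 1), (2 : ℝ) ^ m :=
            Finset.sum_le_sum fun m _ => ite_le_sup _ _ _ |>.trans (by simp)
        _ = 2 ^ (n + 1) - 1 := by rw [geom_sum_eq (by norm_num)]; norm_num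
        _ ≤ 2 * x := by rw [pow_succ]; linarith
    · rwa [Finset.sum_range_succ, if_neg hn, add_zero]

theorem integral_le_add_mul_measureReal {Ω : Type*} {mΩ : MeasurableSpace Ω} {Q : Measure Ω}
    [IsProbabilityMeasure Q] {f : Ω → ℝ} (hf : Integrable f Q) {s : Set Ω} {b c : ℝ}
    (hs : ∀ ω ∉ s, f ω ≤ b) (hle : ∀ ω, f ω ≤ b + c) :
    ∫ ω, f ω ∂Q ≤ b + c * Q.real s := by
  have hmeas := measurableSet_toMeasurable Q s
  have hind := (integrable_const (μ := Q) c).indicator hmeas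
  calc ∫ ω, f ω ∂Q ≤ ∫ ω, (b + (toMeasurable Q s).indicator (fun _ => c) ω) ∂Q := by
        refine integral_mono hf ((integrable_const b).add hind) fun ω => ?_
        by_cases hω : ω ∈ toMeasurable Q s
        · simpa [hω] using hle ω
        · simpa [hω] using hs ω fun h => hω (subset_toMeasurable Q s h)
    _ = b + c * Q.real s := by
        rw [integral_add (integrable_const b) hind, integral_indicator_const _ hmeas]
        simp [measureReal_def, measure_toMeasurable, mul_comm]

namespace Setup

variable {V K : ℕ} {P : Setup V K}

/-- The real number `λK / ((1 - 2α) v_min)`: epoch `m` has `⌈P.baseLen * 4 ^ m⌉` exploration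
rounds. -/
noncomputable def baseLen (P : Setup V K) : ℝ := P.lam * K / ((1 - 2 * P.α) * vMin P.G 1)

section Epoch

variable (hP : P.Admissible)

include hP

theorem Admissible.baseLen_nonneg : 0 ≤ P.baseLen :=
  div_nonneg (mul_nonneg P.lam_nonneg K.cast_nonneg) hP.one_sub_mul_vMin_pos.le

theorem Admissible.len_le (m : ℕ) : (P.len m : ℝ) ≤ P.baseLen * 4 ^ m + 1 := by
  have hlen : P.baseLen * 4 ^ m = P.lam * K * 2 ^ (2 * m) / ((1 - 2 * P.α) * vMin P.G 1) := by
    rw [baseLen, pow_mul]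
    norm_num
    ring
  rw [len, ← hlen]
  exact (Nat.ceil_lt_add_one (mul_nonneg hP.baseLen_nonneg (by positivity))).le

variable [NeZero K]

theorem Admissible.one_le_baseLen (hV : V ≤ P.lam) : 1 ≤ P.baseLen := by
  have hK : (1 : ℝ) ≤ K := Nat.one_le_cast.mpr NeZero.one_le
  rw [baseLen, one_le_div hP.one_sub_mul_vMin_pos]
  exact (hP.one_sub_mul_vMin_le.trans hV).trans (le_mul_of_one_le_right P.lam_nonneg hK)

variable {ν : Fin K → Measure ℝ} {ξ : Path V K} {m : ℕ} {i : Fin V}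
  (hgap : P.GapBounds ν ξ m) (hi : i ∉ P.byz)

include hgap hi

theorem Admissible.pulls_mul_subGap_le {k : Fin K} (hk : k ≠ P.lead m i (P.gap ξ m i)) :
    P.pulls ξ m i k * subGap ν k ≤
      67 * P.lam / ((1 - 2 * P.α) * vLoc P.G 1 i) * (subGap ν k)⁻¹ := by
  have hv := hP.one_sub_mul_vLoc_pos i
  have hlam := P.lam_nonneg
  obtain hzero | hpos := (subGap_nonneg ν k).eq_or_lt
  · simp [← hzero]
  calc P.pulls ξ m i k * subGap ν k
      ≤ 16 * P.lam * (P.gap ξ m i k ^ 2)⁻¹ / ((1 - 2 * P.α) * vLoc P.G 1 i) * subGap ν k := by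
        rw [pulls, alloc_of_ne hk]
        gcongr
        exact min_le_left _ _
    _ ≤ 16 * P.lam * ((24 / 49 * subGap ν k) ^ 2)⁻¹ / ((1 - 2 * P.α) * vLoc P.G 1 i) *
          subGap ν k := by
        gcongr
        exact (hgap i hi k).2
    _ = 16 * (49 / 24) ^ 2 * P.lam / ((1 - 2 * P.α) * vLoc P.G 1 i) * (subGap ν k)⁻¹ := by
        field_simp
    _ ≤ 67 * P.lam / ((1 - 2 * P.α) * vLoc P.G 1 i) * (subGap ν k)⁻¹ := by
        gcongr
        norm_num

theorem Admissible.pulls_lead_add_one_mul_subGap_le (hV : V ≤ P.lam) {k : Fin K}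
    (hk : k = P.lead m i (P.gap ξ m i)) :
    (P.pulls ξ m i k + 1) * subGap ν k ≤
      7 * P.baseLen * (if 2 ^ m ≤ 3 / minGap ν then 2 ^ m else 0) := by
  have hbase := hP.one_le_baseLen hV
  obtain hzero | hpos := (subGap_nonneg ν k).eq_or_lt
  · rw [← hzero, mul_zero]
    split_ifs <;> positivity
  have hsub : 2 ^ m * subGap ν k ≤ 49 / 24 := by
    have hgap_lead : 24 / 49 * subGap ν k ≤ (1 / 2) ^ m := by
      rw [← hP.gap_lead ξ m i, ← hk]
      exact (hgap i hi k).2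
    rw [one_div_pow, le_div_iff₀ (by positivity)] at hgap_lead
    linarith
  have hpulls : P.pulls ξ m i k ≤ P.len m := by
    rw [← P.sum_alloc m i (P.gap ξ m i)]
    exact Finset.single_le_sum (fun l _ => hP.alloc_nonneg m i (P.gap ξ m i) l) (Finset.mem_univ k)
  have hmin : 2 ^ m * minGap ν ≤ 2 ^ m * subGap ν k := by
    gcongr
    exact minGap_le hpos
  have hlen : (P.len m : ℝ) + 1 ≤ 3 * P.baseLen * 4 ^ m := by
    have hpow : (1 : ℝ) ≤ 4 ^ m := one_le_pow₀ (by norm_num)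
    linarith [hP.len_le m, one_le_mul_of_one_le_of_one_le hbase hpow]
  rw [if_pos (by rw [le_div_iff₀ (minGap_pos hpos)]; linarith)]
  calc (P.pulls ξ m i k + 1) * subGap ν k
      ≤ 3 * P.baseLen * 4 ^ m * subGap ν k := by
        gcongr
        linarith
    _ = 3 * P.baseLen * 2 ^ m * (2 ^ m * subGap ν k) := by
        rw [show (4 : ℝ) = 2 * 2 by norm_num, mul_pow]
        ring
    _ ≤ 3 * P.baseLen * 2 ^ m * (49 / 24) := by gcongr
    _ = 49 / 8 * P.baseLen * 2 ^ m := by ring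
    _ ≤ 7 * P.baseLen * 2 ^ m := by
        gcongr
        norm_num

theorem Admissible.epochRegret_le (hV : V ≤ P.lam) :
    P.epochRegret ν ξ m i ≤
      67 * P.lam / ((1 - 2 * P.α) * vLoc P.G 1 i) * ∑ k with 0 < subGap ν k, (subGap ν k)⁻¹ +
        7 * P.baseLen * (if 2 ^ m ≤ 3 / minGap ν then 2 ^ m else 0) := by
  classical
  set a := P.lead m i (P.gap ξ m i) with ha
  have hv := hP.one_sub_mul_vLoc_pos i
  have hlam := P.lam_nonneg
  have hinv : ∀ k, 0 ≤ (subGap ν k)⁻¹ := fun k => inv_nonneg.mpr (subGap_nonneg ν k)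
  have hrest : ∑ k ∈ Finset.univ.erase a, P.pulls ξ m i k * subGap ν k ≤
      67 * P.lam / ((1 - 2 * P.α) * vLoc P.G 1 i) *
        ∑ k with 0 < subGap ν k, (subGap ν k)⁻¹ := by
    rw [Finset.sum_filter_of_ne fun k _ hk =>
      (subGap_nonneg ν k).lt_of_ne' fun h => hk (by rw [h, inv_zero]), Finset.mul_sum]
    refine (Finset.sum_le_sum fun k hk =>
      hP.pulls_mul_subGap_le hgap hi (Finset.ne_of_mem_erase hk)).trans ?_
    exact Finset.sum_le_univ_sum_of_nonneg fun k => mul_nonneg (by positivity) (hinv k)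
  have hlead := hP.pulls_lead_add_one_mul_subGap_le hgap hi hV ha
  rw [epochRegret, ← Finset.add_sum_erase _ _ (Finset.mem_univ a)]
  linarith

end Epoch

variable {V K : ℕ} {P : Setup V K}

section Regret

variable [NeZero K] {ν : Fin K → Measure ℝ} [∀ k, IsProbabilityMeasure (ν k)]
  {i : Fin V} (hP : P.Admissible) (hν : ∀ k, ∀ᵐ y ∂(ν k), y ∈ Set.Icc (0 : ℝ) 1)
  (hV : V ≤ P.lam) (hi : i ∉ P.byz)

include hP hν hV hi

theorem Admissible.sum_epochRegret_le {ξ : Path V K}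
    (hacc : ∀ m < P.numEpochs, P.Accurate ν ξ m) :
    ∑ m ∈ Finset.range P.numEpochs, P.epochRegret ν ξ m i ≤
      P.numEpochs * (67 * P.lam / ((1 - 2 * P.α) * vLoc P.G 1 i) *
        ∑ k with 0 < subGap ν k, (subGap ν k)⁻¹) + 42 * P.baseLen / minGap ν := by
  have hgap : ∀ m < P.numEpochs, P.GapBounds ν ξ m := fun m hm =>
    hP.gapBounds (mean_mem_Icc hν) fun m' hm' => hacc m' (hm'.trans hm)
  have hbase := hP.baseLen_nonneg
  have hgeom := sum_two_pow_of_le (div_nonneg zero_le_three (minGap_nonneg ν)) P.numEpochs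
  refine (Finset.sum_le_sum fun m hm =>
    hP.epochRegret_le (hgap m (Finset.mem_range.mp hm)) hi hV).trans ?_
  rw [Finset.sum_add_distrib, Finset.sum_const, Finset.card_range, nsmul_eq_mul, ← Finset.mul_sum]
  gcongr
  calc 7 * P.baseLen * ∑ m ∈ Finset.range P.numEpochs, (if 2 ^ m ≤ 3 / minGap ν then 2 ^ m else 0)
      ≤ 7 * P.baseLen * (2 * (3 / minGap ν)) := by gcongr
    _ = 42 * P.baseLen / minGap ν := by ring

variable {Ω : Type*} [MeasurableSpace Ω] {Q : Measure Ω} [IsProbabilityMeasure Q]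
  (E : P.Environment ν Q) (hT : 1 ≤ P.T)

include hT

theorem Environment.regret_le :
    regret P ν E i ≤
      P.numEpochs * (67 * P.lam / ((1 - 2 * P.α) * vLoc P.G 1 i) *
        ∑ k with 0 < subGap ν k, (subGap ν k)⁻¹) + 42 * P.baseLen / minGap ν + K * 2 ^ V := by
  set b := P.numEpochs * (67 * P.lam / ((1 - 2 * P.α) * vLoc P.G 1 i) *
    ∑ k with 0 < subGap ν k, (subGap ν k)⁻¹) + 42 * P.baseLen / minGap ν
  set bad : Set Ω := {ω | ∃ m < P.numEpochs, ¬ P.Accurate ν (E.path ω) m}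
  have hb : 0 ≤ b := by
    have := P.lam_nonneg
    have := hP.one_sub_mul_vLoc_pos i
    have := hP.baseLen_nonneg
    have := minGap_nonneg ν
    have := Finset.sum_nonneg fun k (_ : k ∈ Finset.univ.filter fun k => 0 < subGap ν k) =>
      inv_nonneg.mpr (subGap_nonneg ν k)
    positivity
  have hgood : ∀ ω ∉ bad, ∑ t ∈ Finset.range P.T, P.roundRegret ν (E.path ω) t i ≤ b := by
    intro ω hω
    refine (hP.sum_roundRegret_le hT).trans (hP.sum_epochRegret_le hν hV hi fun m hm => ?_)
    by_contra h
    exact hω ⟨m, hm, h⟩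
  have htriv : ∀ ω, ∑ t ∈ Finset.range P.T, P.roundRegret ν (E.path ω) t i ≤ b + P.T := by
    intro ω
    refine (Finset.sum_le_card_nsmul _ _ 1 fun t _ =>
      hP.roundRegret_le_one hT (mean_mem_Icc hν)).trans ?_
    simpa using hb
  have hbad : P.T * Q.real bad ≤ K * 2 ^ V := by
    have hT' : (0 : ℝ) < P.T := Nat.cast_pos.mpr hT
    rw [← le_div_iff₀' hT']
    exact ENNReal.toReal_le_of_le_ofReal (by positivity) (E.measure_not_accurate_le hP hT hν)
  rw [E.regret_eq hν hP hT hi]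
  refine (integral_le_add_mul_measureReal (integrable_finsetSum _ fun t _ =>
    E.integrable_roundRegret t i hν hP hT) hgood htriv).trans ?_
  gcongr

omit hV in
theorem Environment.regret_eq_zero (hopt : ∀ k, subGap ν k = 0) : regret P ν E i = 0 := by
  simp [E.regret_eq hν hP hT hi, roundRegret, hopt]

end Regret

/-! ### Long horizons -/

section LongHorizon

variable (hlong : K * 2 ^ V ≤ Real.log (V * P.T))

include hlong

theorem mul_le_log_horizon : K * V ≤ Real.log (V * P.T) := by
  refine le_trans ?_ hlong
  gcongr
  exact_mod_cast V.lt_two_pow_self.le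

variable [NeZero K]

theorem one_le_log_horizon : 1 ≤ Real.log (V * P.T) := by
  refine le_trans ?_ hlong
  exact_mod_cast Nat.one_le_iff_ne_zero.mpr (mul_ne_zero (NeZero.ne K) (by positivity))

theorem card_le_log_horizon : V ≤ Real.log (V * P.T) :=
  (le_mul_of_one_le_left V.cast_nonneg (Nat.one_le_cast.mpr (NeZero.one_le (n := K)))).trans
    (mul_le_log_horizon hlong)

variable (hP : P.Admissible) (hT : 1 ≤ P.T)

include hP hT

theorem Admissible.lam_le : P.lam ≤ 1024 * Real.log (V * P.T) := by
  rw [hP.lam_eq hT]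
  linarith [one_le_log_horizon hlong, Real.log_two_lt_d9]

theorem Admissible.card_le_lam : V ≤ P.lam := by
  rw [hP.lam_eq hT]
  linarith [card_le_log_horizon hlong, one_le_log_horizon hlong, Real.log_two_gt_d9]

theorem Admissible.numEpochs_le_log : P.numEpochs ≤ 3 * Real.log (V * P.T) := by
  rw [numEpochs, Nat.cast_add_one]
  linarith [hP.natLog_le hT, one_le_log_horizon hlong]

end LongHorizon

section Rate

variable [NeZero K] {ν : Fin K → Measure ℝ} {k : Fin K} {i : Fin V}
  (hP : P.Admissible) (hlong : K * 2 ^ V ≤ Real.log (V * P.T))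
  (hmean : ∀ k, mean ν k ∈ Set.Icc (0 : ℝ) 1) (hk : 0 < subGap ν k)

include hlong hmean hk

theorem le_sum_log_div : K ≤ ∑ k with 0 < subGap ν k,
    Real.log (V * P.T) / (vLoc P.G 1 i * subGap ν k) := by
  have hv : (0 : ℝ) < vLoc P.G 1 i := Nat.cast_pos.mpr (vLoc_pos P.G 1 i)
  have hvV : (vLoc P.G 1 i : ℝ) ≤ V := Nat.cast_le.mpr (vLoc_le P.G 1 i)
  have hKv : K ≤ Real.log (V * P.T) / vLoc P.G 1 i := by
    rw [le_div_iff₀ hv]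
    exact (mul_le_mul_of_nonneg_left hvV K.cast_nonneg).trans (mul_le_log_horizon hlong)
  simp_rw [div_mul_eq_div_mul_one_div, one_div, ← Finset.mul_sum]
  exact hKv.trans (le_mul_of_one_le_right (K.cast_nonneg.trans hKv)
    (one_le_sum_inv_subGap hmean hk))

include hP

theorem Admissible.div_vMin_mul_minGap_le : K / (vMin P.G 1 * minGap ν) ≤
    (∑ k with 0 < subGap ν k, Real.log (V * P.T) / (vLoc P.G 1 i * subGap ν k)) +
      K * Real.log (1 / minGap ν) / (vMin P.G 1 * minGap ν) := by
  have := hP.connected.nonempty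
  have hv : (1 : ℝ) ≤ vMin P.G 1 := Nat.one_le_cast.mpr (vMin_pos P.G 1)
  calc K / (vMin P.G 1 * minGap ν) = K / vMin P.G 1 * (1 / minGap ν) :=
      div_mul_eq_div_mul_one_div ..
    _ ≤ K / vMin P.G 1 * (1 + Real.log (1 / minGap ν) / minGap ν) := by
        gcongr
        exact one_div_le_one_add_log_div (minGap_pos hk)
    _ = K / vMin P.G 1 + K * Real.log (1 / minGap ν) / (vMin P.G 1 * minGap ν) := by ring
    _ ≤ _ := by
        gcongr
        exact (div_le_self K.cast_nonneg hv).trans (le_sum_log_div hlong hmean hk)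

variable (hT : 1 ≤ P.T)

include hT

theorem Admissible.baseLen_div_minGap_le : 42 * P.baseLen / minGap ν ≤
    43008 * (Real.log (V * P.T) / (1 - 2 * P.α) *
      ((∑ k with 0 < subGap ν k, Real.log (V * P.T) / (vLoc P.G 1 i * subGap ν k)) +
        K * Real.log (1 / minGap ν) / (vMin P.G 1 * minGap ν))) := by
  have hα := hP.one_sub_pos
  have hℓ := one_le_log_horizon hlong
  have hD : 0 ≤ K / (vMin P.G 1 * minGap ν) :=
    div_nonneg K.cast_nonneg (mul_nonneg (Nat.cast_nonneg _) (minGap_nonneg ν))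
  calc 42 * P.baseLen / minGap ν
      = 42 * (P.lam / (1 - 2 * P.α) * (K / (vMin P.G 1 * minGap ν))) := by
        rw [baseLen, ← div_mul_div_comm]
        ring
    _ ≤ 42 * (1024 * Real.log (V * P.T) / (1 - 2 * P.α) *
          ((∑ k with 0 < subGap ν k, Real.log (V * P.T) / (vLoc P.G 1 i * subGap ν k)) +
            K * Real.log (1 / minGap ν) / (vMin P.G 1 * minGap ν))) := by
        gcongr
        · exact hP.lam_le hlong hT
        · exact hP.div_vMin_mul_minGap_le hlong hmean hk
    _ = _ := by ring

omit hmean hk in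
theorem Admissible.numEpochs_mul_le :
    P.numEpochs * (67 * P.lam / ((1 - 2 * P.α) * vLoc P.G 1 i) *
      ∑ k with 0 < subGap ν k, (subGap ν k)⁻¹) ≤
    205824 * (Real.log (V * P.T) / (1 - 2 * P.α) *
      ∑ k with 0 < subGap ν k, Real.log (V * P.T) / (vLoc P.G 1 i * subGap ν k)) := by
  have hℓ := one_le_log_horizon hlong
  have hv := hP.one_sub_mul_vLoc_pos i
  have hS : 0 ≤ ∑ k with 0 < subGap ν k, (subGap ν k)⁻¹ :=
    Finset.sum_nonneg fun k _ => inv_nonneg.mpr (subGap_nonneg ν k)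
  have hlam := P.lam_nonneg
  calc P.numEpochs * (67 * P.lam / ((1 - 2 * P.α) * vLoc P.G 1 i) *
        ∑ k with 0 < subGap ν k, (subGap ν k)⁻¹)
      ≤ 3 * Real.log (V * P.T) * (67 * (1024 * Real.log (V * P.T)) /
          ((1 - 2 * P.α) * vLoc P.G 1 i) * ∑ k with 0 < subGap ν k, (subGap ν k)⁻¹) := by
        gcongr
        · exact hP.numEpochs_le_log hlong hT
        · exact hP.lam_le hlong hT
    _ = _ := by
        simp_rw [div_mul_eq_div_mul_one_div, one_div, ← Finset.mul_sum]
        ring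

end Rate

/-! ### The regret bound -/

section RegretBound

variable [NeZero K] {ν : Fin K → Measure ℝ} [∀ k, IsProbabilityMeasure (ν k)] {i : Fin V}
  {Ω : Type*} [MeasurableSpace Ω] {Q : Measure Ω} [IsProbabilityMeasure Q]
  (E : P.Environment ν Q) (hP : P.Admissible) (hT : 1 ≤ P.T)
  (hlong : K * 2 ^ V ≤ Real.log (V * P.T)) (hν : ∀ k, ∀ᵐ y ∂(ν k), y ∈ Set.Icc (0 : ℝ) 1)
  (hi : i ∉ P.byz)

include hP hT hlong hν hi

theorem Environment.regret_le_of_subGap_pos {k : Fin K} (hk : 0 < subGap ν k) :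
    regret P ν E i ≤ 248833 * (Real.log (V * P.T) / (1 - 2 * P.α) *
      ((∑ k with 0 < subGap ν k, Real.log (V * P.T) / (vLoc P.G 1 i * subGap ν k)) +
        K * Real.log (1 / minGap ν) / (vMin P.G 1 * minGap ν))) := by
  set ℓ := Real.log (V * P.T)
  set X := ∑ k with 0 < subGap ν k, ℓ / (vLoc P.G 1 i * subGap ν k)
  set Y := K * Real.log (1 / minGap ν) / (vMin P.G 1 * minGap ν)
  have hmean := mean_mem_Icc hν
  have hℓ : 1 ≤ ℓ := one_le_log_horizon hlong
  have hα := hP.one_sub_pos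
  have hX : 1 ≤ X := (Nat.one_le_cast.mpr (NeZero.one_le (n := K))).trans
    (le_sum_log_div hlong hmean hk)
  have hY : 0 ≤ Y := by
    have hgap : minGap ν ≤ 1 := (minGap_le hk).trans (subGap_le_one hmean k)
    have hlog := Real.log_nonneg (one_le_one_div (minGap_pos hk) hgap)
    have := minGap_nonneg ν
    positivity
  have hbad : K * 2 ^ V ≤ ℓ / (1 - 2 * P.α) * X := by
    refine hlong.trans ((le_div_self (by linarith) hα hP.one_sub_le).trans ?_)
    exact le_mul_of_one_le_right (by positivity) hX
  have hXY : ℓ / (1 - 2 * P.α) * X ≤ ℓ / (1 - 2 * P.α) * (X + Y) := by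
    gcongr
    exact le_add_of_nonneg_right hY
  calc regret P ν E i
      ≤ 205824 * (ℓ / (1 - 2 * P.α) * X) + 43008 * (ℓ / (1 - 2 * P.α) * (X + Y)) +
          ℓ / (1 - 2 * P.α) * X :=
        (E.regret_le hP hν (hP.card_le_lam hlong hT) hi hT).trans <| add_le_add_three
          (hP.numEpochs_mul_le hlong hT) (hP.baseLen_div_minGap_le hlong hmean hk hT) hbad
    _ ≤ 248833 * (ℓ / (1 - 2 * P.α) * (X + Y)) := by linarith

theorem Environment.regret_le_of_long :
    regret P ν E i ≤ 248833 * (Real.log (V * P.T) / (1 - 2 * P.α) *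
      ((∑ k with 0 < subGap ν k, Real.log (V * P.T) / (vLoc P.G 1 i * subGap ν k)) +
        K * Real.log (1 / minGap ν) / (vMin P.G 1 * minGap ν))) := by
  by_cases hopt : ∀ k, subGap ν k = 0
  · have : IsEmpty {k // 0 < subGap ν k} := ⟨fun k => k.2.ne' (hopt k)⟩
    simp [E.regret_eq_zero hP hν hi hT hopt, hopt, minGap, Real.iInf_of_isEmpty]
  · push Not at hopt
    obtain ⟨k, hk⟩ := hopt
    exact E.regret_le_of_subGap_pos hP hT hlong hν hi ((subGap_nonneg ν k).lt_of_ne' hk)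

end RegretBound

end Setup

end DeMABAR

open DeMABAR MeasureTheory in
theorem theorem2 :
    ∃ C : ℝ, 0 < C ∧ ∀ (V K : ℕ) [NeZero K],
      (∀ P : Setup V K, P.Admissible → 1 ≤ P.T →
        (P.cost : ℝ) ≤ C * (V * Real.log (V * P.T))) ∧
      ∃ T₀ : ℕ, ∀ P : Setup V K, P.Admissible → T₀ ≤ P.T →
        ∀ ν : Fin K → Measure ℝ,
          (∀ k, IsProbabilityMeasure (ν k)) →
          (∀ k, ∀ᵐ y ∂(ν k), y ∈ Set.Icc (0 : ℝ) 1) →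
        ∀ (Ω : Type*) [MeasurableSpace Ω] (Q : Measure Ω) [IsProbabilityMeasure Q]
          (E : P.Environment ν Q) (i : Fin V), i ∉ P.byz →
          regret P ν E i ≤ C * (Real.log (V * P.T) / (1 - 2 * P.α) *
            ((∑ k with 0 < subGap ν k, Real.log (V * P.T) / (vLoc P.G 1 i * subGap ν k)) +
              K * Real.log (1 / minGap ν) / (vMin P.G 1 * minGap ν))) := by
  refine ⟨248833, by norm_num, fun V K _ => ⟨fun P hP hT => ?_, ⌈Real.exp (K * 2 ^ V)⌉₊,
    fun P hP hT ν _ hν Ω _ Q _ E i hi => ?_⟩⟩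
  · have hlog := Real.log_nonneg (hP.one_le_mul hT)
    refine (hP.cost_le hT).trans ?_
    gcongr
    norm_num
  · have hexp : Real.exp (K * 2 ^ V) ≤ P.T := Nat.ceil_le.mp hT
    have hT' : 1 ≤ P.T := Nat.cast_pos.mp ((Real.exp_pos _).trans_le hexp)
    have hV : (1 : ℝ) ≤ V := Nat.one_le_cast.mpr (Fin.pos i)
    have hlong : K * 2 ^ V ≤ Real.log (V * P.T) :=
      (Real.le_log_iff_exp_le (by positivity)).mpr
        (hexp.trans (le_mul_of_one_le_left P.T.cast_nonneg hV))
    exact E.regret_le_of_long hP hT' hlong hν hi
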